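/- Conventions. All rings are commutative with $1$. A $\phi\sigma$-ring is a ring with two commuting ring endomorphisms $\phi,\sigma$; a $\sigma$-ring is a ring with one endomorphism $\sigma$; algebras over such rings have structure maps compatible with the given endomorphisms. Let $K$ be a $\phi\sigma$-field and $C=K^\phi=\{a\in K\mid \phi(a)=a\}$ (a $\sigma$-field). A $\phi$-pseudo field is a nonzero Noetherian $\phi$-ring whose only $\phi$-stable ideals are $0$ and the whole ring, and in which every nonzero divisor is invertible. For $A\in \mathrm{GL}_n(K)$, a $\sigma$-Picard–Vessiot extension for $\phi(Y)=AY$ is a $K$-$\phi\sigma$-algebra $L_A$ that is a $\phi$-pseudo field, with $L_A^\phi=K^\phi$, for which there is $U\in\mathrm{GL}_n(L_A)$ with $\phi(U)=AU$ such that $L_A=K\langle U\rangle_\sigma$, i.e. $L_A$ is the smallest $\phi$- and $\sigma$-stable $K$-subalgebra of $L_A$ that contains the entries of $U$ and is a $\phi$-pseudo field. Its $\sigma$-Picard–Vessiot ring $S_A=K\{U,1/\det U\}_\sigma\subseteq L_A$ is the smallest $\sigma$-stable $K$-subalgebra containing the entries of $U$ and $1/\det U$; it is a $K$-$\phi\sigma$-algebra.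 For $S=S_A$ the $\sigma$-Galois group $G=\mathrm{Gal}^\sigma(L_A|K)$ is the functor that sends a $C$-$\sigma$-algebra $B$ to the group $G(B)$ of all $K\otimes_C B$-linear ring automorphisms of $S\otimes_C B$ that commute with $\phi$ and $\sigma$, where $\phi$ acts as the identity on $B$. Its coordinate ring is the $C$-$\sigma$-algebra $C\{G\}=(S\otimes_K S)^\phi$, and $G$ is called $\sigma$-integral if $C\{G\}$ is an integral domain and $\sigma\colon C\{G\}\to C\{G\}$ is injective. A $K$-subalgebra $M\subseteq S$ is stable under $G$ if, for every $C$-$\sigma$-algebra $B$, every $\tau\in G(B)$ maps $M\otimes_C B$ into $M\otimes_C B$ (inside $S\otimes_C B$). Let $\mu(S|K)$ be the set of $\sigma$-bounded elements of $S$, i.e. of those $b\in S$ for which the sequence of Krull dimensions $\dim K[b,\sigma(b),\dots,\sigma^i(b)]$, $i\in\mathbb{N}$, is bounded. Let $\pi(S|K)$ be the set of elements of $S$ that are $\sigma$-algebraic over $K$, i.e. of those $b\in S$ with $p(b,\sigma(b),\dots,\sigma^i(b))=0$ for some $i$ and some nonzero polynomial $p$ over $K$. Cases. In Case 2S, $K=\mathbb{C}(x)$,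 $\phi(x)=x+h_1$, $\sigma(x)=x+h_2$ with $h_1,h_2\in\mathbb{C}$ linearly independent over $\mathbb{Z}$. In Cases 2Q and 2M, $K=\bigcup_{j\ge 1}\mathbb{C}(x^{1/j})$. In Case 2Q, $\phi(x)=q_1x$, $\sigma(x)=q_2x$ with $q_1,q_2\in\mathbb{C}^*$ multiplicatively independent and not both algebraic numbers all of whose Galois conjugates have modulus one. In Case 2M, $\phi(x)=x^{p_1}$, $\sigma(x)=x^{p_2}$ with $p_1,p_2$ multiplicatively independent positive integers. In all cases $\phi,\sigma$ are commuting automorphisms of $K$ that fix $\mathbb{C}$; in Cases 2Q and 2M any such pair with the prescribed values at $x$ is allowed. Theorem. (1) Let $K$ be a $\phi\sigma$-field of characteristic zero such that $\sigma\colon K\to K$ is surjective and $C=K^\phi$ is algebraically closed. Let $S$ be a $\sigma$-Picard–Vessiot ring over $K$ (for some system $\phi(Y)=AY$, $A\in\mathrm{GL}_n(K)$), and suppose that its $\sigma$-Galois group $G$ is $\sigma$-integral. Then $\mu(S|K)$ is a $\sigma$-stable $K$-subalgebra of $S$ and is stable under $G$. (2) Let $K$ be one of the $\phi\sigma$-fields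 of Cases 2S, 2Q, 2M, let $A\in\mathrm{GL}_n(K)$, and let $L_A$ be a $\sigma$-Picard–Vessiot extension for $\phi(Y)=AY$ with $\sigma$-Picard–Vessiot ring $S_A\subseteq L_A$. Assume that $L_A$ is a field. Then $\pi(S_A|K)$ is a $K$-$\phi\sigma$-subalgebra of $S_A$ and is stable under $\mathrm{Gal}^\sigma(L_A|K)$. -/

import Mathlib

open scoped TensorProduct

universe u v w

/-! ### Difference rings and difference algebras -/

/-- A `σ`-ring: a commutative ring with a ring endomorphism `σ`. -/
class SigmaRing (R : Type*) [CommRing R] where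
  /-- the endomorphism `σ` -/
  sigma : R →+* R

/-- A `φσ`-ring: a commutative ring with two commuting ring endomorphisms `φ` and `σ`. -/
class PhiSigmaRing (R : Type*) [CommRing R] extends SigmaRing R where
  /-- the endomorphism `φ` -/
  phi : R →+* R
  phi_sigma : ∀ x : R, phi (sigma x) = sigma (phi x)

open SigmaRing PhiSigmaRing

/-- `R` is a `k`-`σ`-algebra. -/
class SigmaAlgebra (k R : Type*) [CommRing k] [SigmaRing k] [CommRing R] [SigmaRing R]
    [Algebra k R] : Prop where
  sigma_algebraMap : ∀ a : k, sigma (algebraMap k R a) = algebraMap k R (sigma a)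

/-- `R` is a `k`-`φσ`-algebra. -/
class PhiSigmaAlgebra (k R : Type*) [CommRing k] [PhiSigmaRing k] [CommRing R] [PhiSigmaRing R]
    [Algebra k R] : Prop extends SigmaAlgebra k R where
  phi_algebraMap : ∀ a : k, phi (algebraMap k R a) = algebraMap k R (phi a)

/-- The difference ring `(R, φ)` is simple: it is nonzero and its only `φ`-ideals are `0`
and `R`. -/
def IsPhiSimple (R : Type*) [CommRing R] (φ : R →+* R) : Prop :=
  Nontrivial R ∧ ∀ I : Ideal R, (∀ x ∈ I, φ x ∈ I) → I = ⊥ ∨ I = ⊤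

/-- `(R, φ)` is a `φ`-pseudo field: `φ`-simple, Noetherian, and every nonzero divisor is
invertible. -/
def IsPhiPseudoField (R : Type*) [CommRing R] (φ : R →+* R) : Prop :=
  IsPhiSimple R φ ∧ IsNoetherianRing R ∧ ∀ x ∈ nonZeroDivisors R, IsUnit x

/-! ### The `σ`-field of constants `C = K^φ` -/

/-- The field of constants `C = K^φ`. -/
def constants (K : Type*) [Field K] [PhiSigmaRing K] : Subfield K :=
  (phi : K →+* K).eqLocusField (RingHom.id K)

instance constantsSigmaRing (K : Type*) [Field K] [PhiSigmaRing K] :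
    SigmaRing (constants K) where
  sigma := (sigma : K →+* K).restrict (constants K) (constants K) (by
    intro x hx
    change phi (sigma x) = sigma x
    have hx' : phi x = x := hx
    rw [phi_sigma, hx'])

/-! ### Endomorphisms of tensor products -/

/-- The ring homomorphism `α ⊗ β : A ⊗[k] B → A' ⊗[k'] B'`, `a ⊗ b ↦ α a ⊗ β b`, for ring
homomorphisms `α`, `β` that are semilinear over `κ : k → k'`. -/
noncomputable def tensorMap {k k' A A' B B' : Type*} [CommRing k] [CommRing k']
    [CommRing A] [CommRing A'] [CommRing B] [CommRing B'] [Algebra k A] [Algebra k B]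
    [Algebra k' A'] [Algebra k' B'] (κ : k →+* k') (α : A →+* A') (β : B →+* B')
    (hα : ∀ a, α (algebraMap k A a) = algebraMap k' A' (κ a))
    (hβ : ∀ a, β (algebraMap k B a) = algebraMap k' B' (κ a)) :
    A ⊗[k] B →+* A' ⊗[k'] B' :=
  letI : Algebra k (A' ⊗[k'] B') := ((algebraMap k' (A' ⊗[k'] B')).comp κ).toAlgebra
  let f : A →ₐ[k] A' ⊗[k'] B' :=
    { (Algebra.TensorProduct.includeLeft : A' →ₐ[k'] A' ⊗[k'] B').toRingHom.comp α with
      commutes' := fun a => by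
        change (Algebra.TensorProduct.includeLeft : A' →ₐ[k'] A' ⊗[k'] B')
          (α (algebraMap k A a)) = algebraMap k' (A' ⊗[k'] B') (κ a)
        rw [hα, AlgHom.commutes] }
  let g : B →ₐ[k] A' ⊗[k'] B' :=
    { (Algebra.TensorProduct.includeRight : B' →ₐ[k'] A' ⊗[k'] B').toRingHom.comp β with
      commutes' := fun a => by
        change (Algebra.TensorProduct.includeRight : B' →ₐ[k'] A' ⊗[k'] B')
          (β (algebraMap k B a)) = algebraMap k' (A' ⊗[k'] B') (κ a)
        rw [hβ, AlgHom.commutes] }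
  (Algebra.TensorProduct.lift f g fun _ _ => Commute.all _ _).toRingHom

theorem tensorMap_tmul {k k' A A' B B' : Type*} [CommRing k] [CommRing k']
    [CommRing A] [CommRing A'] [CommRing B] [CommRing B'] [Algebra k A] [Algebra k B]
    [Algebra k' A'] [Algebra k' B'] (κ : k →+* k') (α : A →+* A') (β : B →+* B')
    (hα : ∀ a, α (algebraMap k A a) = algebraMap k' A' (κ a))
    (hβ : ∀ a, β (algebraMap k B a) = algebraMap k' B' (κ a)) (a : A) (b : B) :
    tensorMap κ α β hα hβ (a ⊗ₜ[k] b) = α a ⊗ₜ[k'] β b := by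
  let _ : Algebra k (A' ⊗[k'] B') := ((algebraMap k' (A' ⊗[k'] B')).comp κ).toAlgebra
  change (α a ⊗ₜ[k'] (1 : B')) * ((1 : A') ⊗ₜ[k'] β b) = _
  rw [Algebra.TensorProduct.tmul_mul_tmul, mul_one, one_mul]

section Galois

variable (K S : Type*) [Field K] [PhiSigmaRing K] [CommRing S] [PhiSigmaRing S] [Algebra K S]
  [PhiSigmaAlgebra K S]

/-- `φ` on `S ⊗_K S`. -/
noncomputable def phiSelf : S ⊗[K] S →+* S ⊗[K] S :=
  tensorMap phi phi phi (PhiSigmaAlgebra.phi_algebraMap) (PhiSigmaAlgebra.phi_algebraMap)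

/-- `σ` on `S ⊗_K S`. -/
noncomputable def sigmaSelf : S ⊗[K] S →+* S ⊗[K] S :=
  tensorMap sigma sigma sigma (SigmaAlgebra.sigma_algebraMap) (SigmaAlgebra.sigma_algebraMap)

theorem phiSelf_sigmaSelf (x : S ⊗[K] S) :
    phiSelf K S (sigmaSelf K S x) = sigmaSelf K S (phiSelf K S x) := by
  induction x with
  | zero => simp
  | tmul a b => simp only [phiSelf, sigmaSelf, tensorMap_tmul, phi_sigma]
  | add x y hx hy => simp only [map_add, hx, hy]

/-- The coordinate ring `C{G} = (S ⊗_K S)^φ` of the `σ`-Galois group `G`. -/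
noncomputable def coordinateRing : Subring (S ⊗[K] S) :=
  (phiSelf K S).eqLocus (RingHom.id (S ⊗[K] S))

/-- The endomorphism `σ` of `C{G}`. -/
noncomputable def coordinateSigma : coordinateRing K S →+* coordinateRing K S :=
  (sigmaSelf K S).restrict (coordinateRing K S) (coordinateRing K S) (by
    intro x hx
    change phiSelf K S (sigmaSelf K S x) = sigmaSelf K S x
    have hx' : phiSelf K S x = x := hx
    rw [phiSelf_sigmaSelf, hx'])

/-- The `σ`-Galois group is `σ`-integral: `C{G}` is an integral domain on which `σ` is
injective. -/
def GaloisGroupIsSigmaIntegral : Prop :=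
  IsDomain (coordinateRing K S) ∧ Function.Injective (coordinateSigma K S)

section Points

variable (B : Type*) [CommRing B] [SigmaRing B] [Algebra (constants K) B]
  [SigmaAlgebra (constants K) B]

/-- `φ` on `S ⊗_C B`; it is the identity on `B`. -/
noncomputable def phiBase : S ⊗[constants K] B →+* S ⊗[constants K] B :=
  tensorMap (RingHom.id (constants K)) phi (RingHom.id B)
    (fun a => by
      change phi (algebraMap K S (a : K)) = algebraMap K S (a : K)
      have ha : phi (a : K) = a := a.2
      rw [PhiSigmaAlgebra.phi_algebraMap, ha])
    (fun _ => rfl)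

/-- `σ` on `S ⊗_C B`. -/
noncomputable def sigmaBase : S ⊗[constants K] B →+* S ⊗[constants K] B :=
  tensorMap (sigma : constants K →+* constants K) sigma sigma
    (fun a => SigmaAlgebra.sigma_algebraMap (k := K) (R := S) (a : K))
    (fun a => SigmaAlgebra.sigma_algebraMap a)

/-- The group `G(B)` of all `K ⊗_C B`-`φσ`-automorphisms of `S ⊗_C B`. -/
noncomputable def galoisGroup : Subgroup (RingAut (S ⊗[constants K] B)) where
  carrier := {τ | (∀ (a : K) (b : B),
        τ (algebraMap K S a ⊗ₜ[constants K] b) = algebraMap K S a ⊗ₜ[constants K] b) ∧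
      (∀ x, τ (phiBase K S B x) = phiBase K S B (τ x)) ∧
      ∀ x, τ (sigmaBase K S B x) = sigmaBase K S B (τ x)}
  one_mem' := ⟨fun _ _ => rfl, fun _ => rfl, fun _ => rfl⟩
  mul_mem' := by
    rintro τ υ ⟨h1, h2, h3⟩ ⟨h1', h2', h3'⟩
    refine ⟨fun a b => ?_, fun x => ?_, fun x => ?_⟩
    · rw [RingAut.mul_apply, h1', h1]
    · rw [RingAut.mul_apply, RingAut.mul_apply, h2', h2]
    · rw [RingAut.mul_apply, RingAut.mul_apply, h3', h3]
  inv_mem' := by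
    rintro τ ⟨h1, h2, h3⟩
    have key : ∀ x y, τ x = y → τ⁻¹ y = x := by
      rintro x y rfl
      exact τ.symm_apply_apply x
    have key' : ∀ y, τ (τ⁻¹ y) = y := fun y => τ.apply_symm_apply y
    refine ⟨fun a b => key _ _ (h1 a b), fun x => key _ _ ?_, fun x => key _ _ ?_⟩
    · rw [h2, key']
    · rw [h3, key']

variable {S} in
/-- The image of `M ⊗_C B` in `S ⊗_C B`, for a `K`-subalgebra `M` of `S`. (The canonical map
`M ⊗_C B → S ⊗_C B` is injective because `C` is a field.) -/
noncomputable def baseChange (M : Subalgebra K S) :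
    Submodule (constants K) (S ⊗[constants K] B) :=
  LinearMap.range (LinearMap.rTensor B
    ((Subalgebra.toSubmodule M).restrictScalars (constants K)).subtype)

end Points

end Galois

/-- `M` is stable under the action of the `σ`-Galois group: for every `C`-`σ`-algebra `B`,
every `τ ∈ G(B)` maps `M ⊗_C B` into `M ⊗_C B`. -/
def IsGaloisStable.{x, y, z} (K : Type x) {S : Type y} [Field K] [PhiSigmaRing K] [CommRing S]
    [PhiSigmaRing S] [Algebra K S] [PhiSigmaAlgebra K S] (M : Subalgebra K S) : Prop :=
  ∀ (B : Type z) [CommRing B] [SigmaRing B] [Algebra (constants K) B]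
    [SigmaAlgebra (constants K) B], ∀ τ ∈ galoisGroup K S B,
      ∀ x ∈ baseChange K B M, τ x ∈ baseChange K B M

/-! ### `σ`-algebraic and `σ`-bounded elements -/

section Elements

variable (K S : Type*) [Field K] [CommRing S] [SigmaRing S] [Algebra K S]

/-- `μ(S|K)`: the `σ`-bounded elements `b`, i.e. those for which the (Krull) dimensions of the
`K`-algebras `K[b, σ(b), …, σⁱ(b)]` are bounded. -/
def sigmaBoundedElements : Set S :=
  {b | ∃ N : ℕ, ∀ i : ℕ,
    ringKrullDim (Algebra.adjoin K {y : S | ∃ j ≤ i, y = (sigma : S →+* S)^[j] b}) ≤ (N : ℕ∞)}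

/-- `π(S|K)`: the `σ`-algebraic elements `b`, i.e. those satisfying a nonzero `σ`-polynomial
over `K`. A `σ`-polynomial is a polynomial in the variables `y, σ(y), σ²(y), …`. -/
def sigmaAlgebraicElements : Set S :=
  {b | ∃ p : MvPolynomial ℕ K, p ≠ 0 ∧
    MvPolynomial.aeval (fun j : ℕ => (sigma : S →+* S)^[j] b) p = 0}

/-- `K{X}_σ`: the smallest `K`-`σ`-subalgebra of `S` containing `X`. -/
def sigmaAdjoin (X : Set S) : Subalgebra K S :=
  sInf {T : Subalgebra K S | X ⊆ T ∧ ∀ x ∈ T, sigma x ∈ T}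

variable {S}

theorem subset_sigmaAdjoin (X : Set S) : X ⊆ sigmaAdjoin K S X := by
  intro x hx
  simp only [sigmaAdjoin, SetLike.mem_coe, Algebra.mem_sInf, Set.mem_ofPred_eq]
  exact fun T hT => hT.1 hx

theorem sigma_mem_sigmaAdjoin {X : Set S} {x : S} (hx : x ∈ sigmaAdjoin K S X) :
    sigma x ∈ sigmaAdjoin K S X := by
  simp only [sigmaAdjoin, Algebra.mem_sInf, Set.mem_ofPred_eq] at hx ⊢
  exact fun T hT => hT.2 _ (hx T hT)

theorem sigmaAdjoin_le {X : Set S} {T : Subalgebra K S} (hX : X ⊆ T)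
    (hT : ∀ x ∈ T, sigma x ∈ T) : sigmaAdjoin K S X ≤ T :=
  sInf_le ⟨hX, hT⟩

end Elements

/-! ### `σ`-Picard-Vessiot extensions -/

/-- The structure of a `σ`-Picard-Vessiot extension for `φ(Y) = AY` on a `K`-`φσ`-algebra `L`,
with a chosen fundamental matrix `U`. -/
structure SigmaPVExtension {K : Type*} [Field K] [PhiSigmaRing K] {n : ℕ} (A : GL (Fin n) K)
    (L : Type*) [CommRing L] [PhiSigmaRing L] [Algebra K L] [PhiSigmaAlgebra K L] where
  /-- `L` is a `φ`-pseudo `σ`-field -/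
  isPhiPseudoField : IsPhiPseudoField L phi
  /-- the fundamental matrix -/
  U : GL (Fin n) L
  /-- `φ(U) = AU` -/
  phi_U : U.1.map phi = A.1.map (algebraMap K L) * U.1
  /-- `L = K⟨U⟩_σ`: `L` is the only `φ`-pseudo `σ`-field between `K` and `L` that contains the
  entries of `U` -/
  generates : ∀ (T : Subalgebra K L) (hφ : ∀ x ∈ T, phi x ∈ T), (∀ x ∈ T, sigma x ∈ T) →
    (∀ i j, U.1 i j ∈ T) → IsPhiPseudoField T ((phi : L →+* L).restrict T T hφ) → T = ⊤
  /-- `L^φ = K^φ` -/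
  constants_eq : ∀ x : L, phi x = x → ∃ c : K, phi c = c ∧ algebraMap K L c = x

namespace SigmaPVExtension

variable {K : Type*} [Field K] [PhiSigmaRing K] {n : ℕ} {A : GL (Fin n) K}
  {L : Type*} [CommRing L] [PhiSigmaRing L] [Algebra K L] [PhiSigmaAlgebra K L]

/-- The `σ`-Picard-Vessiot ring `S_A = K{U, 1/det U}_σ ⊆ L_A`. -/
def ring (P : SigmaPVExtension A L) : Subalgebra K L :=
  sigmaAdjoin K L ({x | ∃ i j, x = P.U.1 i j} ∪ {((Matrix.GeneralLinearGroup.det P.U)⁻¹ : Lˣ).1})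

theorem phi_mem_ring (P : SigmaPVExtension A L) (x : L) (hx : x ∈ P.ring) :
    phi x ∈ P.ring := by
  have hU : ∀ i j, P.U.1 i j ∈ P.ring := fun i j =>
    subset_sigmaAdjoin K _ (Or.inl ⟨i, j, rfl⟩)
  have hd : ((Matrix.GeneralLinearGroup.det P.U)⁻¹ : Lˣ).1 ∈ P.ring :=
    subset_sigmaAdjoin K _ (Or.inr rfl)
  let T : Subalgebra K L :=
    { P.ring.toSubsemiring.comap (phi : L →+* L) with
      algebraMap_mem' := fun a => by
        change phi (algebraMap K L a) ∈ P.ring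
        rw [PhiSigmaAlgebra.phi_algebraMap]
        exact P.ring.algebraMap_mem _ }
  have hT : P.ring ≤ T := by
    refine sigmaAdjoin_le K ?_ ?_
    · rintro x (⟨i, j, rfl⟩ | hx)
      · change phi (P.U.1 i j) ∈ P.ring
        have h := congrFun (congrFun P.phi_U i) j
        rw [Matrix.map_apply] at h
        rw [h, Matrix.mul_apply]
        exact Subalgebra.sum_mem _ fun k _ =>
          P.ring.mul_mem (P.ring.algebraMap_mem _) (hU k j)
      · rw [Set.mem_singleton_iff] at hx
        subst hx
        change phi _ ∈ P.ring
        have hdet : phi (P.U.1.det) = algebraMap K L A.1.det * P.U.1.det := by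
          rw [RingHom.map_det, RingHom.mapMatrix_apply, P.phi_U, Matrix.det_mul,
            ← RingHom.mapMatrix_apply, ← RingHom.map_det]
        set d : Lˣ := Matrix.GeneralLinearGroup.det P.U with hd'
        set a : Kˣ := Matrix.GeneralLinearGroup.det A with ha'
        have hd1 : (d : L) = P.U.1.det := rfl
        have ha1 : (a : K) = A.1.det := rfl
        rw [← hd1, ← ha1] at hdet
        have h1 : phi ((d⁻¹ : Lˣ) : L) * phi (d : L) = 1 := by
          rw [← map_mul, Units.inv_mul, map_one]
        have h2 : algebraMap K L ((a⁻¹ : Kˣ) : K) * algebraMap K L (a : K) = 1 := by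
          rw [← map_mul, Units.inv_mul, map_one]
        have h3 : ((d⁻¹ : Lˣ) : L) * (d : L) = 1 := Units.inv_mul d
        rw [hdet] at h1
        have h4 : phi ((d⁻¹ : Lˣ) : L) =
            algebraMap K L ((a⁻¹ : Kˣ) : K) * ((d⁻¹ : Lˣ) : L) := by
          linear_combination (algebraMap K L ((a⁻¹ : Kˣ) : K) * ((d⁻¹ : Lˣ) : L)) * h1 -
            phi ((d⁻¹ : Lˣ) : L) * ((d⁻¹ : Lˣ) : L) * (d : L) * h2 -
            phi ((d⁻¹ : Lˣ) : L) * h3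
        rw [h4]
        exact P.ring.mul_mem (P.ring.algebraMap_mem _) hd
    · intro x hx
      change phi (sigma x) ∈ P.ring
      rw [phi_sigma]
      exact sigma_mem_sigmaAdjoin K hx
  exact hT hx

noncomputable instance (P : SigmaPVExtension A L) : PhiSigmaRing P.ring where
  sigma := (sigma : L →+* L).restrict P.ring P.ring fun _ hx => sigma_mem_sigmaAdjoin K hx
  phi := (phi : L →+* L).restrict P.ring P.ring P.phi_mem_ring
  phi_sigma := fun x => Subtype.ext (phi_sigma (x : L))

instance (P : SigmaPVExtension A L) : PhiSigmaAlgebra K P.ring where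
  sigma_algebraMap := fun a => Subtype.ext (SigmaAlgebra.sigma_algebraMap a)
  phi_algebraMap := fun a => Subtype.ext (PhiSigmaAlgebra.phi_algebraMap a)

end SigmaPVExtension

/-! ### The base fields of Cases 2S, 2Q and 2M -/

/-- The nonzero complex numbers `a` and `b` are multiplicatively independent. -/
def MultiplicativelyIndependent (a b : ℂ) : Prop :=
  a ≠ 0 ∧ b ≠ 0 ∧ ∀ m n : ℤ, a ^ m * b ^ n = 1 → m = 0 ∧ n = 0

/-- `q` is an algebraic number all of whose Galois conjugates (itself included) have modulus
one. -/
def AllConjugatesModulusOne (q : ℂ) : Prop :=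
  IsAlgebraic ℚ q ∧ ∀ z ∈ (minpoly ℚ q).aroots ℂ, ‖z‖ = 1

/-- The field `ℂ(x^{1/*}) = ⋃_{j ≥ 1} ℂ(x^{1/j})` of ramified rational functions, inside the
field of Hahn series over `ℂ` with rational exponents; the Hahn series `single r 1` is `x^r`. -/
noncomputable def RamifiedRatFunc : IntermediateField ℂ (HahnSeries ℚ ℂ) :=
  ⨆ j : ℕ+, IntermediateField.adjoin ℂ {HahnSeries.single (1 / (j : ℚ)) (1 : ℂ)}

/-- The element `x` of `ℂ(x^{1/*})`. -/
noncomputable def RamifiedRatFunc.X : RamifiedRatFunc :=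
  ⟨HahnSeries.single 1 1, by
    refine (le_iSup (fun j : ℕ+ => IntermediateField.adjoin ℂ
      {HahnSeries.single (1 / (j : ℚ)) (1 : ℂ)}) 1) ?_
    refine IntermediateField.subset_adjoin ℂ _ ?_
    simp⟩

section Cases

variable (K : Type*) [Field K] [PhiSigmaRing K]

/-- Case 2S: `K = ℂ(x)`, `φ` and `σ` are the `ℂ`-automorphisms with `φ(x) = x + h₁` and
`σ(x) = x + h₂`, where `h₁` and `h₂` are `ℤ`-linearly independent. -/
def IsCase2S : Prop :=
  ∃ (e : RatFunc ℂ ≃+* K) (h₁ h₂ : ℂ), LinearIndependent ℤ ![h₁, h₂] ∧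
    (∀ c : ℂ, phi (e (RatFunc.C c)) = e (RatFunc.C c)) ∧
    (∀ c : ℂ, sigma (e (RatFunc.C c)) = e (RatFunc.C c)) ∧
    phi (e RatFunc.X) = e (RatFunc.X + RatFunc.C h₁) ∧
    sigma (e RatFunc.X) = e (RatFunc.X + RatFunc.C h₂)

/-- Case 2Q: `K = ℂ(x^{1/*})`, `φ` and `σ` are (commuting) `ℂ`-automorphisms with `φ(x) = q₁x`
and `σ(x) = q₂x`, where `q₁` and `q₂` are multiplicatively independent and not both algebraic
numbers all of whose conjugates have modulus one. (The choice of roots of `q₁`, `q₂` that occurs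
in `φ(x^{1/j})`, `σ(x^{1/j})` is arbitrary.) -/
def IsCase2Q : Prop :=
  ∃ (e : RamifiedRatFunc ≃+* K) (q₁ q₂ : ℂ), MultiplicativelyIndependent q₁ q₂ ∧
    ¬ (AllConjugatesModulusOne q₁ ∧ AllConjugatesModulusOne q₂) ∧
    (∀ c : ℂ, phi (e (algebraMap ℂ RamifiedRatFunc c)) = e (algebraMap ℂ RamifiedRatFunc c)) ∧
    (∀ c : ℂ, sigma (e (algebraMap ℂ RamifiedRatFunc c)) = e (algebraMap ℂ RamifiedRatFunc c)) ∧
    phi (e RamifiedRatFunc.X) = e (q₁ • RamifiedRatFunc.X) ∧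
    sigma (e RamifiedRatFunc.X) = e (q₂ • RamifiedRatFunc.X)

/-- Case 2M: `K = ℂ(x^{1/*})`, `φ` and `σ` are (commuting) `ℂ`-automorphisms with
`φ(x) = x^{p₁}` and `σ(x) = x^{p₂}`, where `p₁` and `p₂` are multiplicatively independent natural
numbers. (In particular this covers `φ(x^r) = x^{p₁r}` and `σ(x^r) = x^{p₂r}` for all `r ∈ ℚ`.) -/
def IsCase2M : Prop :=
  ∃ (e : RamifiedRatFunc ≃+* K) (p₁ p₂ : ℕ), MultiplicativelyIndependent p₁ p₂ ∧
    (∀ c : ℂ, phi (e (algebraMap ℂ RamifiedRatFunc c)) = e (algebraMap ℂ RamifiedRatFunc c)) ∧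
    (∀ c : ℂ, sigma (e (algebraMap ℂ RamifiedRatFunc c)) = e (algebraMap ℂ RamifiedRatFunc c)) ∧
    phi (e RamifiedRatFunc.X) = e (RamifiedRatFunc.X ^ p₁) ∧
    sigma (e RamifiedRatFunc.X) = e (RamifiedRatFunc.X ^ p₂)

end Cases

/-! ### Points of finitely generated algebras over algebraically closed fields -/

/-! Both parts are one statement. In a domain with injective `σ`, an element is `σ`-algebraic
exactly when its `σ`-orbit has finite transcendence rank over `K`, and this is also `σ`-boundedness
(`mem_sigmaAlgebraicElements_iff`, `mem_sigmaBoundedElements_iff`). Ranks are taken in the matroid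
of algebraic independence. Finite rank makes the subalgebra property immediate, so the content is
stability under `G`.

The torsor isomorphism `S ⊗_C C{G} ≅ S ⊗_K S` (`torsorMap_ring_bijective`) writes `1 ⊗ b = ∑ sᵢ cᵢ`
with `cᵢ ∈ C{G}` linearly independent over `C`. Every `τ ∈ G(B)` then sends `b ⊗ 1` to some `∑ sᵢ ⊗
γᵢ`, so it suffices that the `sᵢ` are `σ`-algebraic when `b` is
(`mem_sigmaAlgebraicElements_of_tmul_eq_sum`). Apply `σʲ` and evaluate the coefficients at a
`C`-point `g`: the elements `∑ᵢ g(σʲcᵢ) σʲ(sᵢ)` inherit every relation over `K` among the `σʲ(b)`,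
so their rank is at most the rank `N` of the orbit of `b`. If `r` points give linearly independent
vectors `(g(σʲcᵢ))ᵢ` for all `j` in a set `A'`, linear algebra recovers `σʲ(sᵢ)` for `j ∈ A'`, and
these have rank at most `rN`. An algebraically independent orbit of `sᵢ` is contradicted once `|A'|
> rN`.

Such points are chosen one at a time. Each must avoid the zeros of nontrivial combinations `dⱼ = ∑ᵢ
aⱼᵢ σʲ(cᵢ)` simultaneously for many `j`, so a product of the `dⱼ` must not be nilpotent. As `S ⊗_K
S` may have zero divisors, this is obtained only for a fixed proportion `1/m` of the `j`
(`exists_many_not_isNilpotent_prod`). All `dⱼ` lie in `S ⊗ σʲ(S₀)` with `S₀` finitely generated.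
Over `E`, an algebraic closure of `K`, only finitely many components of `E ⊗ S₀` matter. The Galois
group of `E` over `K` moves specializations between them with stabilizers of index at most `m`, and
averaging over the group yields one specialization that is good for at least `1/m` of the `j`.

Part (1) needs in addition that `S` is a domain, which descends from `C{G}` along the torsor
isomorphism. Part (2) needs that `σ` is surjective on `K` and that the constants are algebraically
closed in the three cases; there `K^φ` is a copy of `ℂ`. -/

theorem exists_algHom_apply_ne_zero {k R : Type*} [Field k] [IsAlgClosed k] [CommRing R]
    [Algebra k R] [Algebra.FiniteType k R] {d : R} (hd : ¬ IsNilpotent d) :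
    ∃ g : R →ₐ[k] k, g d ≠ 0 := by
  -- Inverting a non-nilpotent `d` leaves a nonzero ring. By Zariski's lemma a maximal ideal of it
  -- is a `k`-point, at which `d` is a unit.
  let Rd := Localization.Away d
  have hnt : Nontrivial Rd := by
    rw [← not_subsingleton_iff_nontrivial,
      IsLocalization.subsingleton_iff (M := Submonoid.powers d)]
    exact hd
  have : Algebra.FiniteType R Rd := inferInstance
  have : Algebra.FiniteType k Rd := Algebra.FiniteType.trans (S := R) ‹_› ‹_›
  obtain ⟨m, hm⟩ := Ideal.exists_maximal Rd
  let _ := Ideal.Quotient.field m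
  have : Algebra.FiniteType k (Rd ⧸ m) :=
    Algebra.FiniteType.of_surjective (Ideal.Quotient.mkₐ k m) (Ideal.Quotient.mkₐ_surjective k m)
  have := finite_of_finite_type_of_isJacobsonRing k (Rd ⧸ m)
  let e : k ≃ₐ[k] (Rd ⧸ m) := AlgEquiv.ofBijective (Algebra.ofId k (Rd ⧸ m))
    IsAlgClosed.algebraMap_bijective_of_isIntegral
  have hu : IsUnit (algebraMap R Rd d) := IsLocalization.Away.algebraMap_isUnit d
  refine ⟨(e.symm : (Rd ⧸ m) →ₐ[k] k).comp
    ((Ideal.Quotient.mkₐ k m).comp (IsScalarTower.toAlgHom k R Rd)), ?_⟩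
  exact (hu.map ((e.symm : (Rd ⧸ m) →ₐ[k] k).comp (Ideal.Quotient.mkₐ k m))).ne_zero

theorem LinearIndependent.exists_dual_eq_single {k A ι : Type*} [Field k] [AddCommGroup A]
    [Module k A] {a : ι → A} (ha : LinearIndependent k a) (i : ι) :
    ∃ f : A →ₗ[k] k, f (a i) = 1 ∧ ∀ j, j ≠ i → f (a j) = 0 := by
  classical
  obtain ⟨f, hf⟩ := LinearMap.exists_extend (p := Submodule.span k (Set.range a))
    ((Finsupp.lapply i).comp ha.repr)
  have key : ∀ j, f (a j) = (Finsupp.single j (1 : k)) i := by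
    intro j
    have hj : a j ∈ Submodule.span k (Set.range a) := Submodule.subset_span ⟨j, rfl⟩
    have := LinearMap.congr_fun hf ⟨a j, hj⟩
    simpa [ha.repr_eq_single j ⟨a j, hj⟩ rfl] using this
  refine ⟨f, by simp [key], fun j hj => by simp [key, hj]⟩

theorem LinearIndependent.eq_zero_of_sum_tmul {k A B ι : Type*} [Field k] [AddCommGroup A]
    [Module k A] [AddCommGroup B] [Module k B] {a : ι → A} (ha : LinearIndependent k a)
    {s : Finset ι} {b : ι → B} (h : ∑ i ∈ s, a i ⊗ₜ[k] b i = 0) : ∀ i ∈ s, b i = 0 := by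
  intro i hi
  obtain ⟨f, hf1, hf0⟩ := ha.exists_dual_eq_single i
  have := congrArg (fun z => TensorProduct.lid k B (f.rTensor B z)) h
  simp only [map_sum, LinearMap.rTensor_tmul, TensorProduct.lid_tmul, map_zero] at this
  rwa [Finset.sum_eq_single_of_mem i hi fun j _ hj => by rw [hf0 j hj, zero_smul], hf1,
    one_smul] at this

theorem TensorProduct.exists_dual_rTensor_ne_zero {k A B : Type*} [Field k] [AddCommGroup A]
    [Module k A] [AddCommGroup B] [Module k B] {x : A ⊗[k] B} (hx : x ≠ 0) :
    ∃ f : A →ₗ[k] k, TensorProduct.lid k B (f.rTensor B x) ≠ 0 := by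
  classical
  by_contra! h
  refine hx ((TensorProduct.equivFinsuppOfBasisLeft (Module.Free.chooseBasis k A)).injective ?_)
  ext i
  rw [TensorProduct.equivFinsuppOfBasisLeft_apply, h, map_zero, Finsupp.zero_apply]

/-- In a basis of `B`, the coefficients of two nonzero factors lie in a finitely generated
subalgebra `A₁` of `A`. A `k`-point of `A₁` at which one nonzero coefficient of each factor survives
specializes both factors to nonzero elements of the domain `B`. -/
theorem isDomain_tensorProduct {k A B : Type*} [Field k] [IsAlgClosed k] [CommRing A]
    [IsDomain A] [CommRing B] [IsDomain B] [Algebra k A] [Algebra k B] : IsDomain (A ⊗[k] B) := by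
  classical
  have : NoZeroDivisors (A ⊗[k] B) := by
    refine ⟨fun {x y} hxy => ?_⟩
    let b := Module.Free.chooseBasis k B
    obtain ⟨f, rfl⟩ := TensorProduct.eq_repr_basis_right b x
    obtain ⟨f', rfl⟩ := TensorProduct.eq_repr_basis_right b y
    by_contra! hne
    obtain ⟨i, hi⟩ : ∃ i, f i ≠ 0 := by
      by_contra! h
      exact hne.1 (by rw [show f = 0 from Finsupp.ext h]; simp)
    obtain ⟨j, hj⟩ : ∃ i, f' i ≠ 0 := by
      by_contra! h
      exact hne.2 (by rw [show f' = 0 from Finsupp.ext h]; simp)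
    let X : Finset A := f.support.image f ∪ f'.support.image f'
    let A₁ := Algebra.adjoin k (X : Set A)
    have hf : ∀ l, f l ∈ A₁ := by
      intro l
      by_cases hl : f l = 0
      · rw [hl]; exact A₁.zero_mem
      · exact Algebra.subset_adjoin (Finset.mem_coe.2 (Finset.mem_union_left _
          (Finset.mem_image_of_mem _ (Finsupp.mem_support_iff.2 hl))))
    have hf' : ∀ l, f' l ∈ A₁ := by
      intro l
      by_cases hl : f' l = 0
      · rw [hl]; exact A₁.zero_mem
      · exact Algebra.subset_adjoin (Finset.mem_coe.2 (Finset.mem_union_right _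
          (Finset.mem_image_of_mem _ (Finsupp.mem_support_iff.2 hl))))
    have : Algebra.FiniteType k A₁ :=
      (Subalgebra.fg_iff_finiteType A₁).1 ⟨X, rfl⟩
    let d : A₁ := ⟨f i, hf i⟩ * ⟨f' j, hf' j⟩
    have hd : ¬ IsNilpotent d := by
      rw [isNilpotent_iff_eq_zero]
      intro h
      exact mul_ne_zero hi hj (congrArg Subtype.val h)
    obtain ⟨g, hg⟩ := exists_algHom_apply_ne_zero (k := k) hd
    let x₁ : A₁ ⊗[k] B := ∑ l ∈ f.support, (⟨f l, hf l⟩ : A₁) ⊗ₜ b l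
    let y₁ : A₁ ⊗[k] B := ∑ l ∈ f'.support, (⟨f' l, hf' l⟩ : A₁) ⊗ₜ b l
    have hinj : Function.Injective (Algebra.TensorProduct.map A₁.val (AlgHom.id k B)) :=
      Module.Flat.rTensor_preserves_injective_linearMap (M := B) A₁.val.toLinearMap
        Subtype.val_injective
    have hxy₁ : x₁ * y₁ = 0 := by
      apply hinj
      simp only [map_mul, x₁, y₁, map_sum, Algebra.TensorProduct.map_tmul, map_zero]
      exact hxy
    let Φ : A₁ ⊗[k] B →ₐ[k] B :=
      Algebra.TensorProduct.lift ((Algebra.ofId k B).comp g) (AlgHom.id k B) fun _ _ => .all _ _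
    have h0 : Φ x₁ * Φ y₁ = 0 := by rw [← map_mul, hxy₁, map_zero]
    have hΦ : ∀ (s : Finset _) (F : _ → A₁), Φ (∑ l ∈ s, F l ⊗ₜ b l) = ∑ l ∈ s, g (F l) • b l := by
      intro s F
      simp [Φ, Algebra.ofId_apply, Algebra.smul_def]
    have hg' : g ⟨f i, hf i⟩ * g ⟨f' j, hf' j⟩ ≠ 0 := by rw [← map_mul]; exact hg
    rcases mul_eq_zero.1 h0 with h | h
    · rw [hΦ] at h
      exact left_ne_zero_of_mul hg'
        (linearIndependent_iff'.1 b.linearIndependent _ _ h i (Finsupp.mem_support_iff.2 hi))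
    · rw [hΦ] at h
      exact right_ne_zero_of_mul hg'
        (linearIndependent_iff'.1 b.linearIndependent _ _ h j (Finsupp.mem_support_iff.2 hj))
  exact NoZeroDivisors.to_isDomain _

/-! ### Krull dimension and transcendence degree -/

/-- Incomparability makes contraction of primes strictly monotone, which bounds the dimension of
`B`. Lying over and going up lift chains from `A`; the induction remembers what the last prime lies
over. -/
theorem ringKrullDim_eq_of_integral_injective {A B : Type*} [CommRing A] [CommRing B]
    [Algebra A B] [Algebra.IsIntegral A B] (h : Function.Injective (algebraMap A B)) :
    ringKrullDim B = ringKrullDim A := by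
  apply le_antisymm
  · refine Order.krullDim_le_of_strictMono (PrimeSpectrum.comap (algebraMap A B)) ?_
    intro P Q hPQ
    obtain ⟨x, hxQ, hxP⟩ := SetLike.exists_of_lt (show P.asIdeal < Q.asIdeal from hPQ)
    exact Ideal.comap_lt_comap_of_integral_mem_sdiff (I := P.asIdeal) (J := Q.asIdeal) hPQ.le
      ⟨hxQ, hxP⟩ (Algebra.IsIntegral.isIntegral x)
  · have key : ∀ n : ℕ, ∀ l : LTSeries (PrimeSpectrum A), l.length = n →
        ∃ l' : LTSeries (PrimeSpectrum B), l'.length = n ∧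
          (l'.last).asIdeal.comap (algebraMap A B) = l.last.asIdeal := by
      intro n
      induction n with
      | zero =>
        intro l hl
        obtain ⟨Q, -, hQ, hQ'⟩ := Ideal.exists_ideal_over_prime_of_isIntegral (S := B)
          l.last.asIdeal ⊥ (by
            rw [← RingHom.ker_eq_comap_bot, (RingHom.injective_iff_ker_eq_bot _).1 h]
            exact bot_le)
        exact ⟨RelSeries.singleton _ ⟨Q, hQ⟩, rfl, hQ'⟩
      | succ n ih =>
        intro l hl
        obtain ⟨l', hl', hlast⟩ := ih l.eraseLast (by simp [hl])
        have hlt : l.eraseLast.last < l.last := l.eraseLast_last_rel_last (by omega)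
        obtain ⟨Q, hQ1, hQ, hQ'⟩ := Ideal.exists_ideal_over_prime_of_isIntegral (S := B)
          l.last.asIdeal l'.last.asIdeal (by rw [hlast]; exact hlt.le)
        have hlt' : l'.last < (⟨Q, hQ⟩ : PrimeSpectrum B) := by
          refine lt_of_le_of_ne hQ1 fun h' => hlt.ne (PrimeSpectrum.ext ?_)
          rw [← hlast, h', hQ']
        refine ⟨l'.snoc ⟨Q, hQ⟩ hlt', by rw [RelSeries.snoc_length, hl'], ?_⟩
        rw [RelSeries.last_snoc]
        exact hQ'
    refine iSup_le fun l => ?_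
    obtain ⟨l', hl', -⟩ := key _ l rfl
    rw [← hl']
    exact Order.LTSeries.length_le_krullDim l'

open AlgebraicIndependent in
theorem subset_matroid_closure_adjoin {k S : Type*} [Field k] [CommRing S] [IsDomain S]
    [Algebra k S] (X : Set S) : (Algebra.adjoin k X : Set S) ⊆ (matroid k S).closure X := by
  intro y hy
  rw [matroid_closure_eq]
  exact isAlgebraic_algebraMap (⟨y, hy⟩ : Algebra.adjoin k X)

open AlgebraicIndependent in
/-- The Krull dimension of a finitely generated subalgebra of a domain is the rank of its
generators in the matroid of algebraic independence. -/
theorem ringKrullDim_adjoin {k S : Type*} [Field k] [CommRing S] [IsDomain S] [Algebra k S]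
    {X : Set S} (hX : X.Finite) :
    ∃ n : ℕ, ringKrullDim (Algebra.adjoin k X) = n ∧ (matroid k S).eRk X = n := by
  have : Algebra.FiniteType k (Algebra.adjoin k X) :=
    (Subalgebra.fg_iff_finiteType _).1 ⟨hX.toFinset, by simp⟩
  -- Noether normalization: the number `s` of polynomial variables is both the Krull dimension and
  -- the rank.
  obtain ⟨s, g, hg, hint⟩ := exists_integral_inj_algHom_of_fg k (Algebra.adjoin k X)
  refine ⟨s, ?_, ?_⟩
  · let _ := g.toRingHom.toAlgebra
    have : Algebra.IsIntegral (MvPolynomial (Fin s) k) (Algebra.adjoin k X) := ⟨hint⟩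
    rw [ringKrullDim_eq_of_integral_injective (A := MvPolynomial (Fin s) k) hg,
      MvPolynomial.ringKrullDim_of_isNoetherianRing]
    simp
  · let h : MvPolynomial (Fin s) k →ₐ[k] S := (Algebra.adjoin k X).val.comp g
    have hinj : Function.Injective h := Subtype.val_injective.comp hg
    let v : Fin s → S := fun i => h (MvPolynomial.X i)
    have hv : h = MvPolynomial.aeval v := MvPolynomial.algHom_ext fun i => by simp [v]
    have hind : AlgebraicIndependent k v := by
      rw [algebraicIndependent_iff_injective_aeval, ← hv]
      exact hinj
    have hcl : (matroid k S).closure X = (matroid k S).closure (Set.range v) := by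
      apply Set.Subset.antisymm
      · apply Matroid.closure_subset_closure_of_subset_closure
        intro x hx
        rw [matroid_closure_eq]
        change IsAlgebraic (Algebra.adjoin k (Set.range v)) x
        obtain ⟨p, hp, hpx⟩ := hint ⟨x, Algebra.subset_adjoin hx⟩
        have hr : ∀ q, h q ∈ Algebra.adjoin k (Set.range v) := by
          intro q
          rw [hv, Algebra.adjoin_range_eq_range_aeval]
          exact ⟨q, rfl⟩
        let h' : MvPolynomial (Fin s) k →+* Algebra.adjoin k (Set.range v) :=
          (h.codRestrict _ hr).toRingHom
        refine ⟨p.map h', (hp.map h').ne_zero, ?_⟩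
        rw [Polynomial.aeval_def, Polynomial.eval₂_map]
        have := congrArg (Algebra.adjoin k X).val.toRingHom hpx
        rw [Polynomial.hom_eval₂, map_zero] at this
        exact this
      · apply Matroid.closure_subset_closure_of_subset_closure
        rintro _ ⟨i, rfl⟩
        exact subset_matroid_closure_adjoin X (g (MvPolynomial.X i)).2
    rw [← Matroid.eRk_closure_eq, hcl, Matroid.eRk_closure_eq,
      ((matroid_indep_iff).2 hind.coe_range).eRk_eq_encard,
      ← Set.image_univ, hind.injective.encard_image]
    simp

open AlgebraicIndependent in
/-- If every algebraic relation among the `x i` also holds among the `y i`, then the rank of the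
`y i` is at most that of the `x i`. -/
theorem eRk_range_le_of_relations {k S T ι : Type*} [Field k] [CommRing S] [IsDomain S]
    [Algebra k S] [CommRing T] [IsDomain T] [Algebra k T] {x : ι → S} {y : ι → T}
    (h : ∀ p : MvPolynomial ι k, MvPolynomial.aeval x p = 0 → MvPolynomial.aeval y p = 0) :
    (matroid k T).eRk (Set.range y) ≤ (matroid k S).eRk (Set.range x) := by
  rw [Matroid.eRk_le_iff]
  intro I hI hind
  -- Each member of an independent set of `y`'s gets an index. The `x`'s at these indices are
  -- independent too, since a relation among them would pass to the `y`'s.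
  choose f hf using fun i : I => hI i.2
  have hfi : Function.Injective f := fun a b hab => Subtype.ext (by rw [← hf a, ← hf b, hab])
  have hxi : AlgebraicIndependent k (x ∘ f) := by
    rw [algebraicIndependent_iff]
    intro p hp
    have hI' : AlgebraicIndependent k ((↑) : I → T) := hind
    refine (algebraicIndependent_iff.1 hI') p ?_
    have := h (MvPolynomial.rename f p) (by rwa [MvPolynomial.aeval_rename])
    rw [MvPolynomial.aeval_rename] at this
    convert this using 2
    ext i
    simp [hf]
  calc I.encard = (Set.range (x ∘ f)).encard := by
        rw [← Set.image_univ, hxi.injective.encard_image, Set.encard_univ, ENat.card_coe_set_eq]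
    _ = (matroid k S).eRk (Set.range (x ∘ f)) :=
        ((matroid_indep_iff).2 hxi.coe_range).eRk_eq_encard.symm
    _ ≤ _ := (matroid k S).eRk_mono (Set.range_comp_subset_range f x)

/-! ### Simultaneous membership in cosets of subgroups of bounded index -/

/-- Double counting of the pairs `(g, j)` with `g ∈ Hⱼεⱼ`: each `j` contributes `|Hⱼ| ≥ |G|/m`, so
some `g` is in at least `|A|/m` of the cosets. -/
theorem exists_mem_many_cosets_of_finite {G : Type*} [Group G] [Finite G] (A : Finset ℕ)
    (H : ℕ → Subgroup G) (ε : ℕ → G) (m : ℕ) (hH : ∀ j ∈ A, (H j).index ≤ m) :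
    ∃ g : G, ∃ A' ⊆ A, A.card ≤ m * A'.card ∧ ∀ j ∈ A', g * (ε j)⁻¹ ∈ H j := by
  classical
  have := Fintype.ofFinite G
  by_contra! hcon
  have h1 : ∀ g : G, m * (A.filter fun j => g * (ε j)⁻¹ ∈ H j).card < A.card := by
    intro g
    by_contra! h
    obtain ⟨j, hj, hj'⟩ := hcon g _ (Finset.filter_subset _ A) h
    exact hj' (Finset.mem_filter.1 hj).2
  have h2 : ∑ g : G, (A.filter fun j => g * (ε j)⁻¹ ∈ H j).card = ∑ j ∈ A, Nat.card (H j) := by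
    simp_rw [Finset.card_filter]
    rw [Finset.sum_comm]
    refine Finset.sum_congr rfl fun j _ => ?_
    rw [← Finset.card_filter, Nat.card_eq_fintype_card, Fintype.card_subtype]
    refine Finset.card_bij (fun g _ => g * (ε j)⁻¹) (by simp) (by simp) fun b hb =>
      ⟨b * ε j, by simpa using hb, by simp⟩
  have h3 : ∑ g : G, m * (A.filter fun j => g * (ε j)⁻¹ ∈ H j).card < ∑ g : G, A.card :=
    Finset.sum_lt_sum_of_nonempty Finset.univ_nonempty fun g _ => h1 g
  rw [← Finset.mul_sum, h2, Finset.sum_const, Finset.card_univ, smul_eq_mul, Finset.mul_sum] at h3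
  have h4 : ∑ j ∈ A, Fintype.card G ≤ ∑ j ∈ A, m * Nat.card (H j) := by
    refine Finset.sum_le_sum fun j hj => ?_
    rw [← Nat.card_eq_fintype_card, ← (H j).card_mul_index, mul_comm]
    exact Nat.mul_le_mul_right _ (hH j hj)
  rw [Finset.sum_const, smul_eq_mul, mul_comm] at h4
  exact absurd h3 (not_lt.2 h4)

/-- Reduction to a finite group: nonzero index means finite index, so the normal core of the finite
intersection of the `Hⱼ` has finite index and can be divided out. -/
theorem exists_mem_many_cosets {G : Type*} [Group G] (A : Finset ℕ)
    (H : ℕ → Subgroup G) (ε : ℕ → G) (m : ℕ) (hH : ∀ j ∈ A, (H j).index ≤ m)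
    (hH' : ∀ j ∈ A, (H j).index ≠ 0) :
    ∃ g : G, ∃ A' ⊆ A, A.card ≤ m * A'.card ∧ ∀ j ∈ A', g * (ε j)⁻¹ ∈ H j := by
  let N : Subgroup G := (⨅ j : A, H j).normalCore
  have hfin : (⨅ j : A, H j).FiniteIndex :=
    ⟨Subgroup.index_iInf_ne_zero fun j => hH' j j.2⟩
  have : N.FiniteIndex := inferInstance
  have hNH : ∀ j ∈ A, N ≤ H j := fun j hj =>
    (Subgroup.normalCore_le _).trans (iInf_le (fun j : A => H j) ⟨j, hj⟩)
  have : Finite (G ⧸ N) := inferInstance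
  let π := QuotientGroup.mk' N
  have hπ : Function.Surjective π := QuotientGroup.mk'_surjective N
  have hker : π.ker = N := QuotientGroup.ker_mk' N
  obtain ⟨q, A', hA', hcard, hmem⟩ := exists_mem_many_cosets_of_finite A
    (fun j => (H j).map π) (fun j => π (ε j)) m (fun j hj => by
      rw [Subgroup.index_map_eq _ hπ (by rw [hker]; exact hNH j hj)]
      exact hH j hj)
  obtain ⟨g, rfl⟩ := hπ q
  refine ⟨g, A', hA', hcard, fun j hj => ?_⟩
  have := hmem j hj
  rw [← map_inv, ← map_mul, Subgroup.mem_map] at this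
  obtain ⟨x, hx, hxg⟩ := this
  have h1 : x⁻¹ * (g * (ε j)⁻¹) ∈ N := by
    rw [← hker, MonoidHom.mem_ker, map_mul, map_inv, hxg, inv_mul_cancel]
  simpa using (H j).mul_mem hx (hNH j (hA' hj) h1)

/-! ### Specializations of `k̄ ⊗ S` -/

section Specialization

variable {K : Type*} [Field K] {E : Type*} [Field E] [Algebra K E]
  {S Λ : Type*} [CommRing S] [Algebra K S] [Field Λ] [Algebra K Λ]

/-- The specialization `E ⊗ S → Λ`, `a ⊗ s ↦ ι (γ a) * q s`. -/
noncomputable def twistedSpec (ι : E →ₐ[K] Λ) (q : S →ₐ[K] Λ) (γ : E ≃ₐ[K] E) :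
    E ⊗[K] S →ₐ[K] Λ :=
  Algebra.TensorProduct.lift (ι.comp γ) q fun _ _ => .all _ _

@[simp]
theorem twistedSpec_tmul (ι : E →ₐ[K] Λ) (q : S →ₐ[K] Λ) (γ : E ≃ₐ[K] E) (a : E) (s : S) :
    twistedSpec ι q γ (a ⊗ₜ s) = ι (γ a) * q s := rfl

theorem twistedSpec_mul (ι : E →ₐ[K] Λ) (q : S →ₐ[K] Λ) (γ δ : E ≃ₐ[K] E) (z : E ⊗[K] S) :
    twistedSpec ι q (γ * δ) z =
      twistedSpec ι q γ (Algebra.TensorProduct.map (δ : E →ₐ[K] E) (AlgHom.id K S) z) := by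
  induction z with
  | zero => simp
  | tmul a s => simp
  | add x y hx hy => rw [map_add, map_add, map_add, hx, hy]

/-- Suppose all conjugate specializations of `∑ aₗ ⊗ bₗ` vanish. Multiplying by the conjugates of `c
= aᵢ⁻¹` and summing over the Galois group of a finite normal extension `N` gives `∑ Tr(c aₗ) bₗ = 0`
in `S`, by injectivity of `q`. The `i`-th coefficient is `Tr(1) = [N : K]`, which is nonzero in
characteristic zero. -/
theorem exists_twistedSpec_ne_zero [CharZero K] [IsAlgClosed E] [Algebra.IsAlgebraic K E]
    (ι : E →ₐ[K] Λ) {q : S →ₐ[K] Λ} (hq : Function.Injective q) {y : E ⊗[K] S} (hy : y ≠ 0) :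
    ∃ γ : E ≃ₐ[K] E, twistedSpec ι q γ y ≠ 0 := by
  classical
  by_contra! hcon
  obtain ⟨a, rfl⟩ := TensorProduct.eq_repr_basis_right (Module.Free.chooseBasis K S) y
  set b := Module.Free.chooseBasis K S
  obtain ⟨i, hi⟩ : ∃ i, a i ≠ 0 := by
    by_contra! h
    exact hy (by rw [show a = 0 from Finsupp.ext h]; simp)
  let F := IntermediateField.adjoin K ((a.support.image a : Finset E) : Set E)
  have : FiniteDimensional K F :=
    IntermediateField.finiteDimensional_adjoin fun x _ => Algebra.IsIntegral.isIntegral x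
  let N := IntermediateField.normalClosure K F E
  have : Normal K E := normal_iff.2 fun x => ⟨Algebra.IsIntegral.isIntegral x,
    IsAlgClosed.splits _⟩
  have hFN : F ≤ N := IntermediateField.le_normalClosure F
  have : IsGalois K N := ⟨⟩
  have haN : ∀ l, a l ∈ N := by
    intro l
    by_cases hl : a l = 0
    · rw [hl]; exact N.zero_mem
    · exact hFN (IntermediateField.subset_adjoin _ _ (Finset.mem_coe.2
        (Finset.mem_image_of_mem _ (Finsupp.mem_support_iff.2 hl))))
  let c : N := ⟨(a i)⁻¹, N.inv_mem (haN i)⟩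
  have hlift : ∀ (τ : N ≃ₐ[K] N) (x : N), τ.liftNormal E (x : E) = (τ x : E) :=
    fun τ x => AlgEquiv.liftNormal_commutes τ E x
  have hsum : ∑ l ∈ a.support, Algebra.trace K N (c * ⟨a l, haN l⟩) • b l = 0 := by
    apply hq
    rw [map_sum, map_zero]
    have h1 : ∀ l, q (Algebra.trace K N (c * ⟨a l, haN l⟩) • b l) =
        ∑ τ : N ≃ₐ[K] N, ι (τ.liftNormal E (c : E)) * (ι (τ.liftNormal E (a l)) * q (b l)) := by
      intro l
      have h2 : algebraMap K E (Algebra.trace K N (c * ⟨a l, haN l⟩)) =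
          ∑ τ : N ≃ₐ[K] N, (τ.liftNormal E (c : E)) * (τ.liftNormal E (a l)) := by
        rw [IsScalarTower.algebraMap_apply K N E, trace_eq_sum_automorphisms, map_sum]
        refine Finset.sum_congr rfl fun τ _ => ?_
        rw [map_mul, map_mul]
        congr 1
        · exact (hlift τ c).symm
        · exact (hlift τ ⟨a l, haN l⟩).symm
      rw [map_smul, Algebra.smul_def, ← ι.commutes, h2, map_sum, Finset.sum_mul]
      simp only [map_mul, mul_assoc]
    simp_rw [h1]
    rw [Finset.sum_comm]
    refine Finset.sum_eq_zero fun τ _ => ?_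
    rw [← Finset.mul_sum]
    have := hcon (τ.liftNormal E)
    rw [Finsupp.sum, map_sum] at this
    simp only [twistedSpec_tmul] at this
    rw [this, mul_zero]
  have h0 := linearIndependent_iff'.1 b.linearIndependent _ _ hsum i (Finsupp.mem_support_iff.2 hi)
  have hc : c * ⟨a i, haN i⟩ = 1 := Subtype.ext (inv_mul_cancel₀ hi)
  rw [hc, ← map_one (algebraMap K N), Algebra.trace_algebraMap] at h0
  simp at h0
  exact (Module.finrank_pos (R := K) (M := N)).ne' h0

/-- `E ⊗ S` is integral over `S`, so by incomparability these primes are minimal, and a Noetherian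
ring has finitely many minimal primes. -/
theorem finite_primes_over_bot [Algebra.IsAlgebraic K E] [IsDomain S] [Algebra.FiniteType K S] :
    {Q : Ideal (E ⊗[K] S) | Q.IsPrime ∧
      Q.comap (Algebra.TensorProduct.includeRight : S →ₐ[K] E ⊗[K] S) = ⊥}.Finite := by
  have : IsNoetherianRing (E ⊗[K] S) := Algebra.FiniteType.isNoetherianRing E _
  refine (minimalPrimes.finite_of_isNoetherianRing (E ⊗[K] S)).subset ?_
  rintro Q ⟨hQ, hQ0⟩
  let _ : Algebra S (E ⊗[K] S) :=
    (Algebra.TensorProduct.includeRight : S →ₐ[K] E ⊗[K] S).toRingHom.toAlgebra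
  have halg : algebraMap S (E ⊗[K] S) =
    (Algebra.TensorProduct.includeRight : S →ₐ[K] E ⊗[K] S).toRingHom := rfl
  have hint : ∀ x : E ⊗[K] S, IsIntegral S x := by
    intro x
    induction x with
    | zero => exact isIntegral_zero
    | add x y hx hy => exact hx.add hy
    | tmul a s =>
      have h1 : (a ⊗ₜ[K] s) = (a ⊗ₜ[K] (1 : S)) * algebraMap S (E ⊗[K] S) s := by
        rw [halg]
        simp
      rw [h1]
      refine IsIntegral.mul ?_ isIntegral_algebraMap
      obtain ⟨p, hp, hpa⟩ := Algebra.IsIntegral.isIntegral (R := K) a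
      refine ⟨p.map (algebraMap K S), hp.map _, ?_⟩
      rw [Polynomial.eval₂_map]
      have h2 := congrArg (Algebra.TensorProduct.includeLeft : E →ₐ[K] E ⊗[K] S).toRingHom hpa
      rw [Polynomial.hom_eval₂, map_zero] at h2
      have h3 : (algebraMap S (E ⊗[K] S)).comp (algebraMap K S) =
          (Algebra.TensorProduct.includeLeft : E →ₐ[K] E ⊗[K] S).toRingHom.comp
            (algebraMap K E) := by
        refine RingHom.ext fun r => ?_
        rw [halg]
        exact ((Algebra.TensorProduct.includeRight : S →ₐ[K] E ⊗[K] S).commutes r).trans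
          ((Algebra.TensorProduct.includeLeft : E →ₐ[K] E ⊗[K] S).commutes r).symm
      rw [h3]
      exact h2
  refine ⟨⟨hQ, bot_le⟩, fun P hP hPQ => ?_⟩
  have hPp : P.IsPrime := hP.1
  by_contra hne
  obtain ⟨x, hxQ, hxP⟩ := SetLike.not_le_iff_exists.1 hne
  have hlt := Ideal.comap_lt_comap_of_integral_mem_sdiff (R := S) hPQ ⟨hxQ, hxP⟩ (hint x)
  have hQ0' : Q.comap (algebraMap S (E ⊗[K] S)) = ⊥ := hQ0
  rw [hQ0'] at hlt
  exact not_lt_bot hlt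

/-- The stabilizer of the kernel of a specialization, restricted to the image of a finitely
generated algebra, has index bounded in terms of that algebra. -/
theorem exists_stabilizer_index_le [Algebra.IsAlgebraic K E] [IsDomain S] (ι : E →ₐ[K] Λ)
    {q : S →ₐ[K] Λ} (hq : Function.Injective q) (S₀ : Subalgebra K S) [Algebra.FiniteType K S₀]
    (κ : K →+* K) (κE : E ≃+* E) (s : S₀ →+* S) (hs : Function.Injective s)
    (hκE : ∀ a, (κE : E →+* E) (algebraMap K E a) = algebraMap K E (κ a))
    (hκs : ∀ a, s (algebraMap K S₀ a) = algebraMap K S (κ a)) :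
    ∃ H : Subgroup (E ≃ₐ[K] E), H.index ≤ {Q : Ideal (E ⊗[K] S₀) | Q.IsPrime ∧
      Q.comap (Algebra.TensorProduct.includeRight : S₀ →ₐ[K] E ⊗[K] S₀) = ⊥}.ncard ∧
      H.index ≠ 0 ∧ ∀ δ ∈ H, ∀ ε, ∀ z : E ⊗[K] S₀,
        twistedSpec ι q (δ * ε) (tensorMap κ (κE : E →+* E) s hκE hκs z) = 0 ↔
          twistedSpec ι q ε (tensorMap κ (κE : E →+* E) s hκE hκs z) = 0 := by
  set T : E ⊗[K] S₀ →+* E ⊗[K] S := tensorMap κ (κE : E →+* E) s hκE hκs with hT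
  -- The image of `T` is stable under the Galois action because `κE` is bijective: `δ` on the target
  -- is `κE⁻¹ δ κE` on the source.
  have htrans : ∀ (δ : E ≃ₐ[K] E) (z : E ⊗[K] S₀), ∃ z',
      Algebra.TensorProduct.map (δ : E →ₐ[K] E) (AlgHom.id K S) (T z) = T z' := by
    intro δ z
    induction z with
    | zero => exact ⟨0, by simp⟩
    | add x y hx hy =>
      obtain ⟨x', hx⟩ := hx
      obtain ⟨y', hy⟩ := hy
      exact ⟨x' + y', by rw [map_add, map_add, map_add, hx, hy]⟩
    | tmul a t =>
      refine ⟨κE.symm (δ (κE a)) ⊗ₜ t, ?_⟩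
      simp [hT, tensorMap_tmul]
  let ker (γ : E ≃ₐ[K] E) : Ideal (E ⊗[K] S₀) :=
    RingHom.ker ((twistedSpec ι q γ).toRingHom.comp T)
  have hker : ∀ γ z, z ∈ ker γ ↔ twistedSpec ι q γ (T z) = 0 := fun γ z => RingHom.mem_ker
  -- The kernel of a specialization determines the kernels of its right translates, so the group
  -- acts on the kernels and the stabilizer `H` is a subgroup.
  have hright : ∀ {γ δ : E ≃ₐ[K] E}, ker γ = ker δ → ∀ ε, ker (γ * ε) = ker (δ * ε) := by
    intro γ δ h ε
    ext z
    obtain ⟨z', hz'⟩ := htrans ε z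
    rw [hker, hker, twistedSpec_mul, twistedSpec_mul, hz', ← hker, ← hker, h]
  let H : Subgroup (E ≃ₐ[K] E) :=
    { carrier := {δ | ker δ = ker 1}
      one_mem' := rfl
      mul_mem' := fun {γ δ} hγ hδ => by
        have := hright (show ker γ = ker 1 from hγ) δ
        rw [one_mul] at this
        exact this.trans hδ
      inv_mem' := fun {γ} hγ => by
        have := hright (show ker γ = ker 1 from hγ) γ⁻¹
        rw [mul_inv_cancel, one_mul] at this
        exact this.symm }
  set X := {Q : Ideal (E ⊗[K] S₀) | Q.IsPrime ∧
      Q.comap (Algebra.TensorProduct.includeRight : S₀ →ₐ[K] E ⊗[K] S₀) = ⊥} with hX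
  have : IsDomain S₀ := inferInstance
  have hXfin : X.Finite := finite_primes_over_bot
  have : Finite X := hXfin
  have hkX : ∀ γ, ker γ ∈ X := by
    intro γ
    refine ⟨RingHom.ker_isPrime _, ?_⟩
    rw [eq_bot_iff]
    intro t ht
    have ht' : twistedSpec ι q γ (T ((1 : E) ⊗ₜ t)) = 0 := ht
    have hT1 : T ((1 : E) ⊗ₜ t) = 1 ⊗ₜ s t := by rw [hT, tensorMap_tmul, map_one]
    rw [hT1, twistedSpec_tmul, map_one, map_one, one_mul] at ht'
    have h1 : s t = 0 := hq (by rw [ht', map_zero])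
    exact hs (by rw [h1, map_zero])
  -- The inverse appears because the quotient consists of left cosets: `γH = δH` exactly when `γ⁻¹`
  -- and `δ⁻¹` have the same kernel.
  let F : (E ≃ₐ[K] E) ⧸ H → X := Quotient.lift (fun γ => ⟨ker γ⁻¹, hkX γ⁻¹⟩) (by
    intro γ δ hγδ
    have h1 : ker (γ⁻¹ * δ) = ker 1 := QuotientGroup.leftRel_apply.1 hγδ
    have := hright h1 δ⁻¹
    rw [mul_assoc, mul_inv_cancel, mul_one, one_mul] at this
    exact Subtype.ext this)
  have hF : Function.Injective F := by
    intro a b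
    induction a using QuotientGroup.induction_on with | _ γ
    induction b using QuotientGroup.induction_on with | _ δ
    intro h
    have h1 : ker γ⁻¹ = ker δ⁻¹ := congrArg Subtype.val h
    have h2 := hright h1 δ
    rw [inv_mul_cancel] at h2
    exact QuotientGroup.eq.2 h2
  have : Finite ((E ≃ₐ[K] E) ⧸ H) := Finite.of_injective F hF
  refine ⟨H, ?_, ?_, fun δ hδ ε z => ?_⟩
  · rw [← Nat.card_coe_set_eq]
    exact Nat.card_le_card_of_injective F hF
  · exact Subgroup.index_ne_zero_of_finite
  · rw [← hker, ← hker, hright (show ker δ = ker 1 from hδ), one_mul]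

/-- A tensor whose contraction along some functional survives under a specialization is not
nilpotent; in fact a product of such tensors is not. -/
theorem not_isNilpotent_prod_of_twistedSpec_ne_zero [IsAlgClosed E] {Λ₁ : Type*} [Field Λ₁]
    [Algebra K Λ₁] [Algebra E Λ₁] [IsScalarTower K E Λ₁] (p : S →ₐ[K] Λ₁)
    (ι : E →ₐ[K] Λ) (q : S →ₐ[K] Λ) (γ : E ≃ₐ[K] E) {J : Type*} (A : Finset J)
    (d : J → S ⊗[K] S) (f : J → Λ₁ →ₗ[E] E)
    (h : ∀ j ∈ A, twistedSpec ι q γ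
      ((((f j).restrictScalars K).comp p.toLinearMap).rTensor S (d j)) ≠ 0) :
    ¬ IsNilpotent (∏ j ∈ A, d j) := by
  -- The `E`-structure of the right factor is twisted by `γ`, so that contracting the left factor of
  -- `Λ₁ ⊗_E Λ` by `f j` recovers `twistedSpec ι q γ`. Since `E` is algebraically closed this tensor
  -- product is a domain, and it is enough that each `d j` has nonzero image there.
  let _ : Algebra E Λ := (ι.comp (γ : E →ₐ[K] E)).toRingHom.toAlgebra
  have halg : ∀ a, algebraMap E Λ a = ι (γ a) := fun _ => rfl
  have : IsScalarTower K E Λ := .of_algebraMap_eq fun a => by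
    rw [halg, AlgEquiv.commutes, AlgHom.commutes]
  have : IsDomain (Λ₁ ⊗[E] Λ) := isDomain_tensorProduct
  let Θ : S ⊗[K] S →ₐ[K] Λ₁ ⊗[E] Λ := Algebra.TensorProduct.lift
    (((Algebra.TensorProduct.includeLeft : Λ₁ →ₐ[E] Λ₁ ⊗[E] Λ).restrictScalars K).comp p)
    (((Algebra.TensorProduct.includeRight : Λ →ₐ[E] Λ₁ ⊗[E] Λ).restrictScalars K).comp q)
    fun _ _ => .all _ _
  have hΘ : ∀ (g : Λ₁ →ₗ[E] E) (x : S ⊗[K] S),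
      TensorProduct.lid E Λ (g.rTensor Λ (Θ x)) =
        twistedSpec ι q γ (((g.restrictScalars K).comp p.toLinearMap).rTensor S x) := by
    intro g x
    induction x with
    | zero => simp
    | add x y hx hy => simp only [map_add, hx, hy]
    | tmul s t =>
      simp [Θ, Algebra.smul_def, halg]
  have hne : ∀ j ∈ A, Θ (d j) ≠ 0 := by
    intro j hj h0
    apply h j hj
    rw [← hΘ, h0]
    simp
  intro hnil
  have h1 := (hnil.map Θ).eq_zero
  rw [map_prod, Finset.prod_eq_zero_iff] at h1
  obtain ⟨j, hj, hj0⟩ := h1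
  exact hne j hj hj0

end Specialization

/-- View `Λ ⊗_K S` as `Λ ⊗_E (E ⊗_K S)`; a nonzero element has a nonzero coordinate along `Λ`. The
functional is `E`-linear so that the contraction lands in `E ⊗_K S`, where the Galois group acts. -/
theorem exists_dual_rTensor_ne_zero_of_tower {K E Λ S M : Type*} [Field K] [Field E]
    [Algebra K E] [AddCommGroup Λ] [Module K Λ] [Module E Λ] [IsScalarTower K E Λ]
    [AddCommGroup S] [Module K S] [AddCommGroup M] [Module K M] (q : M →ₗ[K] Λ)
    (hq : Function.Injective q) {d : M ⊗[K] S} (hd : d ≠ 0) :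
    ∃ f : Λ →ₗ[E] E, ((f.restrictScalars K).comp q).rTensor S d ≠ 0 := by
  let e := TensorProduct.AlgebraTensorModule.cancelBaseChange K E E Λ S
  have h1 : e.symm (q.rTensor S d) ≠ 0 := by
    rw [Ne, LinearEquiv.map_eq_zero_iff]
    exact fun h => hd (Module.Flat.rTensor_preserves_injective_linearMap (M := S) q hq
      (by rw [h, map_zero]))
  obtain ⟨f, hf⟩ := TensorProduct.exists_dual_rTensor_ne_zero h1
  refine ⟨f, fun h => hf ?_⟩
  have key : ∀ z : Λ ⊗[K] S, TensorProduct.lid E (E ⊗[K] S) (f.rTensor _ (e.symm z)) =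
      (f.restrictScalars K).rTensor S z := by
    intro z
    induction z with
    | zero => simp
    | add x y hx hy => simp only [map_add, hx, hy]
    | tmul a s =>
      simp [e, TensorProduct.smul_tmul']
  rw [key, ← LinearMap.comp_apply, ← LinearMap.rTensor_comp, h]

/-- Given nonzero tensors `d j` in `S ⊗ σʲ(S₀)`, a positive proportion of them, depending only
on the finitely generated algebra `S₀`, has a product that is not nilpotent. -/
theorem exists_many_not_isNilpotent_prod {K S : Type*} [Field K] [CharZero K] [CommRing S]
    [IsDomain S] [Algebra K S] (κ : K ≃+* K) (σ : S →+* S) (hσ : Function.Injective σ)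
    (hκ : ∀ a, σ (algebraMap K S a) = algebraMap K S (κ a)) (S₀ : Subalgebra K S)
    (hS₀ : S₀.FG) :
    ∃ m : ℕ, ∀ (A : Finset ℕ) (d : ℕ → S ⊗[K] S), (∀ j ∈ A, d j ≠ 0) →
      (∀ j ∈ A, d j ∈ AddSubmonoid.closure {z | ∃ s : S, ∃ t ∈ S₀, z = s ⊗ₜ[K] σ^[j] t}) →
      ∃ A' ⊆ A, A.card ≤ m * A'.card ∧ ¬ IsNilpotent (∏ j ∈ A', d j) := by
  classical
  let E := AlgebraicClosure K
  let Λ := AlgebraicClosure (FractionRing S)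
  let ι : E →ₐ[K] Λ := IsAlgClosed.lift
  let q : S →ₐ[K] Λ := IsScalarTower.toAlgHom K S Λ
  have hq : Function.Injective q := by
    have h1 : algebraMap S Λ = (algebraMap (FractionRing S) Λ).comp
      (algebraMap S (FractionRing S)) := IsScalarTower.algebraMap_eq _ _ _
    change Function.Injective (algebraMap S Λ)
    rw [h1]
    exact (algebraMap (FractionRing S) Λ).injective.comp (IsFractionRing.injective S _)
  let _ : Algebra E Λ := ι.toRingHom.toAlgebra
  have : IsScalarTower K E Λ := .of_algebraMap_eq fun a => (ι.commutes a).symm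
  have : Algebra.FiniteType K S₀ := (Subalgebra.fg_iff_finiteType S₀).1 hS₀
  let κE : E ≃+* E := IsAlgClosure.equivOfEquiv E E κ
  have hκE : ∀ a, κE (algebraMap K E a) = algebraMap K E (κ a) :=
    IsAlgClosure.equivOfEquiv_algebraMap E E κ
  have hκEj : ∀ (j : ℕ) (a : K), (κE ^ j) (algebraMap K E a) = algebraMap K E ((κ ^ j) a) := by
    intro j
    induction j with
    | zero => exact fun _ => rfl
    | succ j ih =>
      intro a
      rw [pow_succ, pow_succ, RingAut.mul_apply, RingAut.mul_apply, hκE, ih]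
  have hσj : ∀ (j : ℕ) (a : K), (σ ^ j) (algebraMap K S a) = algebraMap K S ((κ ^ j) a) := by
    intro j
    induction j with
    | zero => exact fun _ => rfl
    | succ j ih =>
      intro a
      rw [pow_succ, pow_succ, RingAut.mul_apply]
      change (σ ^ j) (σ _) = _
      rw [hκ, ih]
  have hσinj : ∀ j : ℕ, Function.Injective (σ ^ j : S →+* S) := by
    intro j
    rw [RingHom.coe_pow]
    exact hσ.iterate j
  let s (j : ℕ) : S₀ →+* S := (σ ^ j : S →+* S).comp S₀.val.toRingHom
  have hs : ∀ j, Function.Injective (s j) := fun j => (hσinj j).comp Subtype.val_injective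
  have hκs : ∀ j a, s j (algebraMap K S₀ a) = algebraMap K S ((κ ^ j : K ≃+* K).toRingHom a) :=
    fun j a => hσj j a
  let T (j : ℕ) : E ⊗[K] S₀ →+* E ⊗[K] S :=
    tensorMap (κ ^ j : K ≃+* K).toRingHom ((κE ^ j : E ≃+* E) : E →+* E) (s j) (hκEj j) (hκs j)
  choose H hH1 hH2 hH3 using fun j => exists_stabilizer_index_le ι hq S₀
    (κ ^ j : K ≃+* K).toRingHom (κE ^ j) (s j) (hs j) (hκEj j) (hκs j)
  -- The constant counts the primes of `E ⊗ S₀` over zero. It does not depend on `j`, because the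
  -- kernels for all `σʲ` are pulled back to this same ring.
  refine ⟨{Q : Ideal (E ⊗[K] S₀) | Q.IsPrime ∧
    Q.comap (Algebra.TensorProduct.includeRight : S₀ →ₐ[K] E ⊗[K] S₀) = ⊥}.ncard,
    fun A d hd hdS => ?_⟩
  · have hf : ∀ j ∈ A, ∃ f : Λ →ₗ[E] E,
        ((f.restrictScalars K).comp q.toLinearMap).rTensor S (d j) ≠ 0 := by
      intro j hj
      refine exists_dual_rTensor_ne_zero_of_tower q.toLinearMap hq (hd j hj)
    choose! f hf using hf
    choose! ε hε using fun j (hj : j ∈ A) => exists_twistedSpec_ne_zero ι hq (hf j hj)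
    -- The contraction of `d j` lies in `E ⊗ σʲ(S₀)`, which is the image of `T j` since `κE ^ j` is
    -- onto.
    have hz : ∀ j ∈ A, ∃ z,
        ((((f j).restrictScalars K).comp q.toLinearMap).rTensor S (d j)) = T j z := by
      intro j hj
      have := hdS j hj
      generalize d j = x at this
      induction this using AddSubmonoid.closure_induction with
      | mem x hx =>
        obtain ⟨u, t, ht, rfl⟩ := hx
        refine ⟨(κE ^ j).symm (f j (q u)) ⊗ₜ ⟨t, ht⟩, ?_⟩
        have h1 : T j ((κE ^ j).symm (f j (q u)) ⊗ₜ ⟨t, ht⟩) =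
            (κE ^ j) ((κE ^ j).symm (f j (q u))) ⊗ₜ (σ ^ j : S →+* S) t :=
          tensorMap_tmul _ _ _ _ _ _ _
        rw [h1, RingEquiv.apply_symm_apply, RingHom.coe_pow]
        rfl
      | zero => exact ⟨0, by simp⟩
      | add x y _ _ hx hy =>
        obtain ⟨x', hx⟩ := hx
        obtain ⟨y', hy⟩ := hy
        exact ⟨x' + y', by rw [map_add, map_add, hx, hy]⟩
    -- Individually chosen `ε j` are replaced by one `g`: if `g (ε j)⁻¹` stabilizes the kernel for
    -- `j`, nonvanishing at `ε j` passes to `g`.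
    obtain ⟨g, A', hA', hcard, hg⟩ := exists_mem_many_cosets A H ε _ (fun j _ => hH1 j)
      (fun j _ => hH2 j)
    refine ⟨A', hA', hcard, not_isNilpotent_prod_of_twistedSpec_ne_zero q ι q g A' d f ?_⟩
    intro j hj
    obtain ⟨z, hz⟩ := hz j (hA' hj)
    have h1 := hε j (hA' hj)
    rw [hz] at h1 ⊢
    have h2 := (hH3 j _ (hg j hj) (ε j) z).not.2 h1
    rwa [inv_mul_cancel_right] at h2

/-! ### `σ`-algebraic and `σ`-bounded elements of a domain -/

open AlgebraicIndependent in
theorem eRk_lt_top_of_forall_mem_adjoin {K S : Type*} [Field K] [CommRing S]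
    [IsDomain S] [Algebra K S] {X Y : Set S} (h : ∀ x ∈ X, x ∈ Algebra.adjoin K Y)
    (hY : (matroid K S).eRk Y < ⊤) : (matroid K S).eRk X < ⊤ :=
  calc (matroid K S).eRk X ≤ (matroid K S).eRk ((matroid K S).closure Y) :=
        (matroid K S).eRk_mono fun x hx => subset_matroid_closure_adjoin Y (h x hx)
    _ = (matroid K S).eRk Y := Matroid.eRk_closure_eq _ _
    _ < ⊤ := hY

theorem sigma_iterate_algebraMap {K S : Type*} [CommRing K] [CommRing S] [SigmaRing K]
    [SigmaRing S] [Algebra K S] [SigmaAlgebra K S] (j : ℕ) (a : K) :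
    (sigma : S →+* S)^[j] (algebraMap K S a) = algebraMap K S ((sigma : K →+* K)^[j] a) := by
  induction j with
  | zero => rfl
  | succ j ih => rw [Function.iterate_succ_apply', ih, SigmaAlgebra.sigma_algebraMap,
      Function.iterate_succ_apply']

section SigmaAlgebraic

open AlgebraicIndependent

variable {K S : Type*} [Field K] [CommRing S] [SigmaRing S] [Algebra K S]

theorem mem_sigmaAlgebraicElements_iff_not_algebraicIndependent {b : S} :
    b ∈ sigmaAlgebraicElements K S ↔
      ¬ AlgebraicIndependent K (fun j : ℕ => (sigma : S →+* S)^[j] b) := by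
  rw [algebraicIndependent_iff]
  simp only [sigmaAlgebraicElements, Set.mem_ofPred_eq]
  push Not
  exact ⟨fun ⟨p, h0, h⟩ => ⟨p, h, h0⟩, fun ⟨p, h, h0⟩ => ⟨p, h0, h⟩⟩

/-- The Krull dimensions are the ranks of initial segments of the orbit. They bound the rank of the
whole orbit because a finite independent subset already lies in an initial segment. -/
theorem mem_sigmaBoundedElements_iff [IsDomain S] {b : S} :
    b ∈ sigmaBoundedElements K S ↔
      (matroid K S).eRk (Set.range fun j : ℕ => (sigma : S →+* S)^[j] b) < ⊤ := by
  set x : ℕ → S := fun j => (sigma : S →+* S)^[j] b with hx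
  have hset : ∀ i, {y : S | ∃ j ≤ i, y = (sigma : S →+* S)^[j] b} = x '' Set.Iic i := by
    intro i
    ext y
    simp only [Set.mem_ofPred_eq, Set.mem_image, Set.mem_Iic, hx, eq_comm]
  have hdim : ∀ i, ∃ n : ℕ,
      ringKrullDim (Algebra.adjoin K {y : S | ∃ j ≤ i, y = (sigma : S →+* S)^[j] b}) = n ∧
      (matroid K S).eRk (x '' Set.Iic i) = n := by
    intro i
    rw [← hset]
    exact ringKrullDim_adjoin (by rw [hset]; exact (Set.finite_Iic i).image x)
  simp only [sigmaBoundedElements, Set.mem_ofPred_eq]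
  constructor
  · rintro ⟨N, hN⟩
    refine lt_of_le_of_lt (b := (N : ℕ∞)) ?_ (ENat.natCast_lt_top N)
    rw [Matroid.eRk_le_iff]
    intro I hI hind
    by_contra! hlt
    -- An independent set with more than `N` elements may be infinite; cutting it down to `N + 1`
    -- elements places it in a finite segment.
    obtain ⟨I', hI', hcard⟩ := Set.exists_subset_encard_eq (Order.add_one_le_of_lt hlt)
    have hfin : I'.Finite := Set.finite_of_encard_eq_coe (k := N + 1) (by rw [hcard]; rfl)
    obtain ⟨i, hi⟩ : ∃ i, I' ⊆ x '' Set.Iic i := by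
      choose f hf using fun y : I' => hI (hI' y.2)
      have := hfin.to_subtype
      obtain ⟨i, hi⟩ := (Set.finite_range f).bddAbove
      exact ⟨i, fun y hy => ⟨f ⟨y, hy⟩, hi ⟨_, rfl⟩, hf ⟨y, hy⟩⟩⟩
    obtain ⟨n, hn1, hn2⟩ := hdim i
    have h1 : I'.encard ≤ n := hn2 ▸ Matroid.eRk_le_iff.1 le_rfl hi (hind.subset hI')
    have h2 : n ≤ N := by
      have := hN i
      rw [hn1] at this
      exact_mod_cast this
    rw [hcard] at h1
    have : N + 1 ≤ n := by exact_mod_cast h1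
    omega
  · intro h
    obtain ⟨N, hN⟩ := ENat.ne_top_iff_exists.1 h.ne
    refine ⟨N, fun i => ?_⟩
    obtain ⟨n, hn1, hn2⟩ := hdim i
    rw [hn1]
    have h1 : (n : ℕ∞) ≤ N := by
      rw [← hn2, hN]
      exact (matroid K S).eRk_mono (Set.image_subset_range x _)
    exact_mod_cast h1

variable [SigmaRing K] [SigmaAlgebra K S] [IsDomain S]

/-- Apply `σ` to an algebraic equation; injectivity keeps the transformed polynomial nonzero. -/
theorem sigma_mem_matroid_closure (hσ : Function.Injective (sigma : S →+* S)) {X : Set S} {y : S}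
    (hy : y ∈ (matroid K S).closure X) :
    sigma y ∈ (matroid K S).closure ((sigma : S →+* S) '' X) := by
  rw [matroid_closure_eq] at hy ⊢
  change IsAlgebraic (Algebra.adjoin K X) y at hy
  change IsAlgebraic (Algebra.adjoin K ((sigma : S →+* S) '' X)) (sigma y)
  obtain ⟨p, hp, hpy⟩ := hy
  have hmem : ∀ z ∈ Algebra.adjoin K X,
      (sigma : S →+* S) z ∈ Algebra.adjoin K ((sigma : S →+* S) '' X) := by
    intro z hz
    induction hz using Algebra.adjoin_induction with
    | mem x hx => exact Algebra.subset_adjoin ⟨x, hx, rfl⟩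
    | algebraMap r =>
      rw [SigmaAlgebra.sigma_algebraMap]
      exact Subalgebra.algebraMap_mem _ _
    | add x y _ _ hx hy => rw [map_add]; exact Subalgebra.add_mem _ hx hy
    | mul x y _ _ hx hy => rw [map_mul]; exact Subalgebra.mul_mem _ hx hy
  let f : Algebra.adjoin K X →+* Algebra.adjoin K ((sigma : S →+* S) '' X) :=
    (sigma : S →+* S).restrict _ _ hmem
  have hf : Function.Injective f := fun a b hab =>
    Subtype.ext (hσ (congrArg Subtype.val hab))
  refine ⟨p.map f, (Polynomial.map_ne_zero_iff hf).2 hp, ?_⟩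
  rw [Polynomial.aeval_def, Polynomial.eval₂_map]
  have := congrArg (sigma : S →+* S) hpy
  rw [Polynomial.aeval_def, Polynomial.hom_eval₂, map_zero] at this
  exact this

/-- For the first `n` with `σⁿ(b)` algebraic over `b, …, σⁿ⁻¹(b)`, the algebraic closure of this
segment is `σ`-stable, hence contains the orbit. Conversely an independent orbit has infinite rank.
-/
theorem mem_sigmaAlgebraicElements_iff (hσ : Function.Injective (sigma : S →+* S)) {b : S} :
    b ∈ sigmaAlgebraicElements K S ↔
      (matroid K S).eRk (Set.range fun j : ℕ => (sigma : S →+* S)^[j] b) < ⊤ := by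
  rw [mem_sigmaAlgebraicElements_iff_not_algebraicIndependent]
  set x : ℕ → S := fun j => (sigma : S →+* S)^[j] b with hx
  have hxs : ∀ j, sigma (x j) = x (j + 1) := fun j =>
    (Function.iterate_succ_apply' (sigma : S →+* S) j b).symm
  constructor
  · intro h
    have hex : ∃ n, ¬ AlgebraicIndepOn K x (Set.Iio n) := by
      by_contra! hcon
      refine h (algebraicIndependent_of_finite_type fun t ht => ?_)
      obtain ⟨n, hn⟩ := ht.bddAbove
      exact (hcon (n + 1)).mono fun i hi => Nat.lt_succ_of_le (hn hi)
    classical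
    obtain ⟨n, hn⟩ : ∃ n, AlgebraicIndepOn K x (Set.Iio n) ∧
        ¬ AlgebraicIndepOn K x (Set.Iio (n + 1)) := by
      have h0 : Nat.find hex ≠ 0 := by
        intro h0
        apply Nat.find_spec hex
        rw [h0]
        have : IsEmpty (Set.Iio 0) := ⟨fun i => Nat.not_lt_zero _ i.2⟩
        exact algebraicIndependent_empty_type_iff.2 (algebraMap K S).injective
      obtain ⟨n, hn⟩ := Nat.exists_eq_succ_of_ne_zero h0
      refine ⟨n, not_not.1 (Nat.find_min hex (by omega)), ?_⟩
      rw [← Nat.succ_eq_add_one, ← hn]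
      exact Nat.find_spec hex
    have hins : Set.Iio (n + 1) = insert n (Set.Iio n) := by
      ext i
      simp only [Set.mem_Iio, Set.mem_insert_iff]
      omega
    have hxn : x n ∈ (matroid K S).closure (x '' Set.Iio n) := by
      rw [matroid_closure_eq]
      change IsAlgebraic (Algebra.adjoin K (x '' Set.Iio n)) (x n)
      by_contra htr
      apply hn.2
      rw [hins]
      exact hn.1.insert htr
    have hstable : ∀ y ∈ (matroid K S).closure (x '' Set.Iio n),
        sigma y ∈ (matroid K S).closure (x '' Set.Iio n) := by
      intro y hy
      refine Matroid.closure_subset_closure_of_subset_closure ?_ (sigma_mem_matroid_closure hσ hy)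
      rintro _ ⟨_, ⟨i, hi, rfl⟩, rfl⟩
      rw [hxs]
      rcases Nat.lt_or_ge (i + 1) n with h1 | h1
      · exact (matroid K S).mem_closure_of_mem' ⟨i + 1, h1, rfl⟩
      · have : i + 1 = n := le_antisymm hi h1
        rw [this]
        exact hxn
    have hall : ∀ j, x j ∈ (matroid K S).closure (x '' Set.Iio n) := by
      intro j
      induction j with
      | zero =>
        -- For `n = 0` the segment is empty and `b` itself is algebraic over `K`.
        rcases Nat.eq_zero_or_pos n with h1 | h1
        · rw [h1] at hxn ⊢
          exact hxn
        · exact (matroid K S).mem_closure_of_mem' ⟨0, h1, rfl⟩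
      | succ j ih =>
        rw [← hxs]
        exact hstable _ ih
    calc (matroid K S).eRk (Set.range x)
        ≤ (matroid K S).eRk ((matroid K S).closure (x '' Set.Iio n)) :=
          (matroid K S).eRk_mono (by rintro _ ⟨j, rfl⟩; exact hall j)
      _ = (matroid K S).eRk (x '' Set.Iio n) := Matroid.eRk_closure_eq _ _
      _ ≤ (x '' Set.Iio n).encard := Matroid.eRk_le_encard _ _
      _ < ⊤ := ((Set.finite_Iio n).image x).encard_lt_top
  · intro h hind
    rw [((matroid_indep_iff).2 hind.coe_range).eRk_eq_encard, ← Set.image_univ,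
      hind.injective.encard_image] at h
    simp at h

variable (K S) in
/-- The `σ`-algebraic elements of a domain with injective `σ` form a subalgebra. -/
def sigmaAlgebraicSubalgebra (hσ : Function.Injective (sigma : S →+* S)) : Subalgebra K S where
  carrier := sigmaAlgebraicElements K S
  algebraMap_mem' a := by
    rw [mem_sigmaAlgebraicElements_iff hσ]
    refine eRk_lt_top_of_forall_mem_adjoin (Y := ∅) ?_ (by simp)
    rintro _ ⟨j, rfl⟩
    simp only [sigma_iterate_algebraMap]
    exact Subalgebra.algebraMap_mem _ _
  add_mem' {a b} ha hb := by
    rw [mem_sigmaAlgebraicElements_iff hσ] at *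
    refine eRk_lt_top_of_forall_mem_adjoin ?_
      ((Matroid.eRk_union_le_eRk_add_eRk _ _ _).trans_lt (ENat.add_lt_top.2 ⟨ha, hb⟩))
    rintro _ ⟨j, rfl⟩
    simp only [iterate_map_add]
    exact Subalgebra.add_mem _ (Algebra.subset_adjoin (Or.inl ⟨j, rfl⟩))
      (Algebra.subset_adjoin (Or.inr ⟨j, rfl⟩))
  mul_mem' {a b} ha hb := by
    rw [mem_sigmaAlgebraicElements_iff hσ] at *
    refine eRk_lt_top_of_forall_mem_adjoin ?_
      ((Matroid.eRk_union_le_eRk_add_eRk _ _ _).trans_lt (ENat.add_lt_top.2 ⟨ha, hb⟩))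
    rintro _ ⟨j, rfl⟩
    simp only [iterate_map_mul]
    exact Subalgebra.mul_mem _ (Algebra.subset_adjoin (Or.inl ⟨j, rfl⟩))
      (Algebra.subset_adjoin (Or.inr ⟨j, rfl⟩))

theorem sigma_mem_sigmaAlgebraicElements (hσ : Function.Injective (sigma : S →+* S)) {b : S}
    (hb : b ∈ sigmaAlgebraicElements K S) : sigma b ∈ sigmaAlgebraicElements K S := by
  rw [mem_sigmaAlgebraicElements_iff hσ] at *
  refine ((matroid K S).eRk_mono ?_).trans_lt hb
  rintro _ ⟨j, rfl⟩
  exact ⟨j + 1, rfl⟩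

end SigmaAlgebraic

/-- Since `φ` commutes with `σ`, applying it to the coefficients of an equation for `b` gives one
for `φ(b)`, nonzero because `φ` is injective on the field `K`. -/
theorem phi_mem_sigmaAlgebraicElements {K S : Type*} [Field K] [PhiSigmaRing K] [CommRing S]
    [PhiSigmaRing S] [Algebra K S] [PhiSigmaAlgebra K S] {b : S}
    (hb : b ∈ sigmaAlgebraicElements K S) : phi b ∈ sigmaAlgebraicElements K S := by
  obtain ⟨p, hp, hpb⟩ := hb
  refine ⟨p.map phi, (MvPolynomial.map_injective _ (phi : K →+* K).injective).ne_iff'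
    (map_zero _) |>.2 hp, ?_⟩
  have hcomm : ∀ j : ℕ, (sigma : S →+* S)^[j] (phi b) = phi ((sigma : S →+* S)^[j] b) := by
    intro j
    induction j with
    | zero => rfl
    | succ j ih => rw [Function.iterate_succ_apply', ih, Function.iterate_succ_apply', phi_sigma]
  have h1 := congrArg (phi : S →+* S) hpb
  have hcomp : (phi : S →+* S).comp (algebraMap K S) = (algebraMap K S).comp phi :=
    RingHom.ext fun a => PhiSigmaAlgebra.phi_algebraMap a
  rw [MvPolynomial.aeval_def, MvPolynomial.eval₂_comp_left phi, map_zero, hcomp] at h1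
  rw [MvPolynomial.aeval_def, MvPolynomial.eval₂_map]
  simp only [hcomm]
  exact h1

/-! ### The torsor map and selection of points -/

/-- The `α`-image of a basis of `A` stays linearly independent: surjectivity of `κ` lets the
coefficients of a relation be pulled back through the semilinear injective `α`. -/
theorem tensorMap_injective {K A A' B B' : Type*} [Field K] [CommRing A] [CommRing A']
    [CommRing B] [CommRing B'] [Algebra K A] [Algebra K B] [Algebra K A'] [Algebra K B']
    (κ : K →+* K) (α : A →+* A') (β : B →+* B')
    (hα : ∀ a, α (algebraMap K A a) = algebraMap K A' (κ a))
    (hβ : ∀ a, β (algebraMap K B a) = algebraMap K B' (κ a))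
    (hκ : Function.Surjective κ) (hαi : Function.Injective α) (hβi : Function.Injective β) :
    Function.Injective (tensorMap κ α β hα hβ) := by
  rw [injective_iff_map_eq_zero]
  intro z hz
  let b := Module.Free.chooseBasis K A
  obtain ⟨c, rfl⟩ := TensorProduct.eq_repr_basis_left b z
  have hli : LinearIndependent K (fun i => α (b i)) := by
    rw [linearIndependent_iff']
    intro s g hg i hi
    choose g' hg' using fun i => hκ (g i)
    have h1 : α (∑ i ∈ s, g' i • b i) = 0 := by
      rw [← hg, map_sum]
      refine Finset.sum_congr rfl fun j _ => ?_
      rw [Algebra.smul_def, map_mul, hα, hg', Algebra.smul_def]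
    have h2 := linearIndependent_iff'.1 b.linearIndependent s g'
      (hαi (by rw [h1, map_zero])) i hi
    rw [← hg', h2, map_zero]
  rw [Finsupp.sum, map_sum] at hz
  simp only [tensorMap_tmul] at hz
  refine Finset.sum_eq_zero fun i hi => ?_
  have := hli.eq_zero_of_sum_tmul hz i hi
  simp only [hβi (this.trans (map_zero β).symm), TensorProduct.tmul_zero]

section

variable (K S : Type*) [Field K] [PhiSigmaRing K] [CommRing S] [PhiSigmaRing S] [Algebra K S]
  [PhiSigmaAlgebra K S]

/-- The coordinate ring `C{G}` as a `C`-algebra. -/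
noncomputable def coordinateAlgebra : Subalgebra (constants K) (S ⊗[K] S) where
  __ := (coordinateRing K S).toSubsemiring
  algebraMap_mem' c := by
    change phiSelf K S _ = _
    rw [Algebra.TensorProduct.algebraMap_apply]
    change tensorMap _ _ _ _ _ _ = _
    rw [tensorMap_tmul, map_one]
    congr 1
    change phi (algebraMap K S (c : K)) = algebraMap K S (c : K)
    rw [PhiSigmaAlgebra.phi_algebraMap]
    exact congrArg _ c.2

/-- The canonical map `S ⊗_C C{G} → S ⊗_K S`. -/
noncomputable def torsorMap : S ⊗[constants K] coordinateAlgebra K S →ₐ[S] S ⊗[K] S :=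
  Algebra.TensorProduct.lift (Algebra.ofId S (S ⊗[K] S)) (coordinateAlgebra K S).val
    fun _ _ => .all _ _

theorem torsorMap_tmul (s : S) (c : coordinateAlgebra K S) :
    torsorMap K S (s ⊗ₜ c) = s • (c : S ⊗[K] S) := by
  simp [torsorMap, Algebra.smul_def, Algebra.ofId_apply]

end

/-- Selection of points: given tuples `c j` of elements of a finitely generated algebra such that
many nontrivial linear combinations of their entries have a common nonvanishing point, there are
points at which the values of many of the tuples are linearly independent. -/
theorem exists_algHoms_linearIndependent {k R : Type*} [Field k] [IsAlgClosed k] [CommRing R]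
    [Algebra k R] [Algebra.FiniteType k R] {r m : ℕ} (c : ℕ → Fin r → R) (A : Finset ℕ)
    (h : ∀ B ⊆ A, ∀ a : ℕ → Fin r → k, (∀ j ∈ B, a j ≠ 0) → ∃ B' ⊆ B, B.card ≤ m * B'.card ∧
      ¬ IsNilpotent (∏ j ∈ B', ∑ i, a j i • c j i)) :
    ∀ t ≤ r, ∃ A' ⊆ A, A.card ≤ m ^ t * A'.card ∧ ∃ g : Fin t → (R →ₐ[k] k), ∀ j ∈ A',
      LinearIndependent k (fun l : Fin t => fun i : Fin r => g l (c j i)) := by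
  intro t
  induction t with
  | zero =>
    intro _
    exact ⟨A, subset_rfl, by simp, Fin.elim0, fun j _ => linearIndependent_empty_type⟩
  | succ t ih =>
    intro ht
    obtain ⟨A', hA', hcard, g, hg⟩ := ih (by omega)
    -- With `t < r` points the value vectors lie in a hyperplane `f j = 0`. A further point enlarges
    -- the independent family as soon as its value vector avoids that hyperplane.
    have hdual : ∀ j ∈ A', ∃ f : (Fin r → k) →ₗ[k] k, f ≠ 0 ∧
        ∀ l, f (fun i => g l (c j i)) = 0 := by
      intro j hj
      let p := Submodule.span k (Set.range fun l : Fin t => fun i : Fin r => g l (c j i))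
      have hp : p < ⊤ := by
        rw [lt_top_iff_ne_top]
        intro htop
        have h1 : Module.finrank k p ≤ t :=
          (finrank_range_le_card (R := k) fun l : Fin t => fun i : Fin r => g l (c j i)).trans
            (Fintype.card_fin t).le
        rw [htop, finrank_top, Module.finrank_fin_fun] at h1
        omega
      obtain ⟨f, hf0, hf⟩ := Submodule.exists_le_ker_of_lt_top p hp
      exact ⟨f, hf0, fun l => hf (Submodule.subset_span ⟨l, rfl⟩)⟩
    choose! f hf0 hf using hdual
    have hexp : ∀ j (v : Fin r → k), f j v = ∑ i, f j (Pi.single i 1) * v i := by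
      intro j v
      rw [LinearMap.pi_apply_eq_sum_univ (f j) v]
      refine Finset.sum_congr rfl fun i _ => ?_
      rw [smul_eq_mul, mul_comm]
      congr 2
      ext i'
      simp [Pi.single_apply, eq_comm]
    obtain ⟨B, hB, hBcard, hnil⟩ := h A' hA' (fun j i => f j (Pi.single i 1)) (by
      intro j hj h0
      apply hf0 j hj
      ext v
      simpa using congrFun h0 v)
    -- Non-nilpotency of the product yields one point that works for all `j ∈ B`; passing to `B`
    -- costs one factor `m`.
    obtain ⟨γ, hγ⟩ := exists_algHom_apply_ne_zero (k := k) hnil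
    refine ⟨B, hB.trans hA', ?_, Fin.cons γ g, fun j hj => ?_⟩
    · calc A.card ≤ m ^ t * A'.card := hcard
        _ ≤ m ^ t * (m * B.card) := Nat.mul_le_mul_left _ hBcard
        _ = m ^ (t + 1) * B.card := by ring
    · have h1 : (fun l : Fin (t + 1) => fun i : Fin r => (Fin.cons γ g : Fin (t + 1) → _) l (c j i))
          = Fin.cons (fun i => γ (c j i)) (fun l i => g l (c j i)) := by
        ext l i
        refine Fin.cases ?_ (fun l => ?_) l <;> simp
      rw [h1, linearIndependent_finCons]
      refine ⟨hg j (hB hj), fun hmem => ?_⟩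
      have h2 : f j (fun i => γ (c j i)) = 0 := by
        have hle : Submodule.span k (Set.range fun l i => g l (c j i)) ≤ LinearMap.ker (f j) := by
          rw [Submodule.span_le]
          rintro _ ⟨l, rfl⟩
          exact hf j (hB hj) l
        exact hle hmem
      rw [hexp] at h2
      rw [map_prod, Finset.prod_ne_zero_iff] at hγ
      apply hγ j hj
      rw [← h2, map_sum]
      simp

/-! ### Coefficients of the coaction on `σ`-algebraic elements -/

/-- Selecting points requires a finitely generated algebra. For finite `A` only finitely many `c j
i` occur, so the subalgebra they generate suffices, and non-nilpotency in `Z` implies it there. -/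
theorem exists_subalgebra_algHoms_linearIndependent {k Z : Type*} [Field k] [IsAlgClosed k]
    [CommRing Z] [Algebra k Z] {r m : ℕ} (c : ℕ → Fin r → Z) (T : Subalgebra k Z)
    (hc : ∀ j i, c j i ∈ T) (A : Finset ℕ)
    (h : ∀ B ⊆ A, ∀ a : ℕ → Fin r → k, (∀ j ∈ B, a j ≠ 0) → ∃ B' ⊆ B, B.card ≤ m * B'.card ∧
      ¬ IsNilpotent (∏ j ∈ B', ∑ i, a j i • c j i)) :
    ∃ R₁ ≤ T, ∃ c₁ : ℕ → Fin r → R₁, (∀ j ∈ A, ∀ i, (c₁ j i : Z) = c j i) ∧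
      ∃ A' ⊆ A, A.card ≤ m ^ r * A'.card ∧ ∃ g : Fin r → (R₁ →ₐ[k] k),
        ∀ j ∈ A', LinearIndependent k (fun l i => g l (c₁ j i)) := by
  classical
  let X : Finset Z := A.biUnion fun j => Finset.univ.image (c j)
  let R₁ : Subalgebra k Z := Algebra.adjoin k (X : Set Z)
  have : Algebra.FiniteType k R₁ := (Subalgebra.fg_iff_finiteType R₁).1 ⟨X, rfl⟩
  have hcR₁ : ∀ j ∈ A, ∀ i, c j i ∈ R₁ := fun j hj i =>
    Algebra.subset_adjoin (Finset.mem_coe.2 (Finset.mem_biUnion.2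
      ⟨j, hj, Finset.mem_image_of_mem _ (Finset.mem_univ i)⟩))
  have hR₁ : R₁ ≤ T := by
    refine Algebra.adjoin_le ?_
    intro z hz
    obtain ⟨j, -, hz⟩ := Finset.mem_biUnion.1 (Finset.mem_coe.1 hz)
    obtain ⟨i, -, rfl⟩ := Finset.mem_image.1 hz
    exact hc j i
  let c₁ : ℕ → Fin r → R₁ := fun j i => if hj : j ∈ A then ⟨c j i, hcR₁ j hj i⟩ else 0
  have hc₁ : ∀ j ∈ A, ∀ i, (c₁ j i : Z) = c j i := fun j hj i => by
    simp only [c₁, dif_pos hj]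
  refine ⟨R₁, hR₁, c₁, hc₁, exists_algHoms_linearIndependent c₁ A (fun B hB a ha => ?_) r le_rfl⟩
  obtain ⟨B', hB', hcard, hnil⟩ := h B hB a ha
  refine ⟨B', hB', hcard, fun h' => hnil ?_⟩
  have h1 : ∏ j ∈ B', ∑ i, a j i • c j i = R₁.val (∏ j ∈ B', ∑ i, a j i • c₁ j i) := by
    rw [map_prod]
    refine Finset.prod_congr rfl fun j hj => ?_
    rw [map_sum]
    refine Finset.sum_congr rfl fun i _ => ?_
    rw [map_smul]
    exact congrArg (a j i • ·) (hc₁ j (hB (hB' hj)) i).symm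
  rw [h1]
  exact h'.map R₁.val

theorem exists_finset_mem_closure_tmul {K A B : Type*} [CommRing K] [CommRing A] [CommRing B]
    [Algebra K A] [Algebra K B] (z : A ⊗[K] B) :
    ∃ F : Finset B, z ∈ AddSubmonoid.closure {y | ∃ a : A, ∃ t ∈ F, y = a ⊗ₜ[K] t} := by
  classical
  induction z with
  | zero => exact ⟨∅, zero_mem _⟩
  | tmul a t => exact ⟨{t}, AddSubmonoid.subset_closure ⟨a, t, by simp, rfl⟩⟩
  | add x y hx hy =>
    obtain ⟨F, hF⟩ := hx
    obtain ⟨F', hF'⟩ := hy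
    refine ⟨F ∪ F', add_mem (AddSubmonoid.closure_mono ?_ hF) (AddSubmonoid.closure_mono ?_ hF')⟩
    · rintro _ ⟨a, t, ht, rfl⟩
      exact ⟨a, t, Finset.mem_union_left _ ht, rfl⟩
    · rintro _ ⟨a, t, ht, rfl⟩
      exact ⟨a, t, Finset.mem_union_right _ ht, rfl⟩

/-- Membership in `A ⊗ S₀` is phrased by sums of pure tensors so that the semilinear `σʲ` can be
applied to the right factors directly. -/
theorem exists_fg_mem_closure_tmul {K A S : Type*} [CommRing K] [CommRing A] [CommRing S]
    [Algebra K A] [Algebra K S] {r : ℕ} (c : Fin r → A ⊗[K] S) :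
    ∃ S₀ : Subalgebra K S, S₀.FG ∧
      ∀ i, c i ∈ AddSubmonoid.closure {y | ∃ a : A, ∃ t ∈ S₀, y = a ⊗ₜ[K] t} := by
  classical
  choose F hF using fun i => exists_finset_mem_closure_tmul (c i)
  refine ⟨Algebra.adjoin K ((Finset.univ.biUnion F : Finset S) : Set S), ⟨_, rfl⟩, fun i => ?_⟩
  refine AddSubmonoid.closure_mono ?_ (hF i)
  rintro _ ⟨a, t, ht, rfl⟩
  exact ⟨a, t, Algebra.subset_adjoin (Finset.mem_coe.2
    (Finset.mem_biUnion.2 ⟨i, Finset.mem_univ _, ht⟩)), rfl⟩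

theorem smul_mem_closure_tmul {K S : Type*} [CommRing K] [CommRing S] [Algebra K S] {X : Subalgebra K S}
    {τ : S → S} (a : S) {z : S ⊗[K] S}
    (hz : z ∈ AddSubmonoid.closure {y | ∃ a : S, ∃ t ∈ X, y = a ⊗ₜ[K] τ t}) :
    a • z ∈ AddSubmonoid.closure {y | ∃ a : S, ∃ t ∈ X, y = a ⊗ₜ[K] τ t} := by
  induction hz using AddSubmonoid.closure_induction with
  | mem x hx =>
    obtain ⟨a', t, ht, rfl⟩ := hx
    exact AddSubmonoid.subset_closure ⟨a • a', t, ht, rfl⟩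
  | zero => rw [smul_zero]; exact zero_mem _
  | add x y _ _ hx hy => rw [smul_add]; exact add_mem hx hy

theorem constants_smul_eq {K S : Type*} [Field K] [PhiSigmaRing K] [CommRing S] [Algebra K S]
    (a : constants K) (z : S ⊗[K] S) : a • z = algebraMap K S (a : K) • z :=
  (algebraMap_smul S (a : constants K) z).symm

theorem constants_sigma_iterate_coe {K : Type*} [Field K] [PhiSigmaRing K] (j : ℕ)
    (a : constants K) : (((sigma : constants K →+* constants K)^[j] a : constants K) : K) =
      (sigma : K →+* K)^[j] (a : K) := by
  induction j generalizing a with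
  | zero => rfl
  | succ j ih => rw [Function.iterate_succ_apply, Function.iterate_succ_apply, ih]; rfl

open AlgebraicIndependent in
theorem eRk_iUnion_le {α : Type*} (M : Matroid α) {r : ℕ} (Y : Fin r → Set α) (N : ℕ∞)
    (h : ∀ l, M.eRk (Y l) ≤ N) : M.eRk (⋃ l, Y l) ≤ r * N := by
  induction r with
  | zero => simp
  | succ r ih =>
    have : (⋃ l, Y l) = Y 0 ∪ ⋃ l : Fin r, Y l.succ := by
      ext x
      simp [Fin.exists_fin_succ]
    rw [this]
    refine (M.eRk_union_le_eRk_add_eRk _ _).trans ((add_le_add (h 0) (ih _ fun l => h _)).trans ?_)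
    rw [Nat.cast_add, Nat.cast_one, add_mul, one_mul, add_comm]

/-- The `r` independent vectors span `Cʳ`, so the linear system can be solved for each `σʲ(sᵢ)` with
coefficients in `C ⊆ K`. -/
theorem sigma_iterate_mem_adjoin_coaction {K S : Type*} [Field K] [PhiSigmaRing K]
    [CommRing S] [PhiSigmaRing S] [Algebra K S] {r : ℕ} (s : Fin r → S) (j : ℕ)
    (v : Fin r → Fin r → constants K) (hv : LinearIndependent (constants K) v) (i₀ : Fin r) :
    (sigma : S →+* S)^[j] (s i₀) ∈ Algebra.adjoin K
      (Set.range fun l => ∑ i, v l i • (sigma : S →+* S)^[j] (s i)) := by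
  have hspan := hv.span_eq_top_of_card_eq_finrank' (by simp)
  have h1 : (Pi.single i₀ 1 : Fin r → constants K) ∈
      Submodule.span (constants K) (Set.range v) := by
    rw [hspan]; trivial
  obtain ⟨a, ha⟩ := (Submodule.mem_span_range_iff_exists_fun _).1 h1
  have h2 : (sigma : S →+* S)^[j] (s i₀) =
      ∑ l, a l • ∑ i, v l i • (sigma : S →+* S)^[j] (s i) := by
    simp only [Finset.smul_sum, smul_smul]
    rw [Finset.sum_comm]
    simp only [← Finset.sum_smul]
    have h3 : ∀ i, ∑ l, a l * v l i = (Pi.single i₀ 1 : Fin r → constants K) i := by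
      intro i
      rw [← ha]
      simp
    simp only [h3]
    rw [Finset.sum_eq_single i₀ (fun i _ hi => by simp [hi]) (by simp)]
    simp
  rw [h2]
  refine Subalgebra.sum_mem _ fun l _ => ?_
  exact Subalgebra.smul_mem _ (Algebra.subset_adjoin (Set.mem_range_self l)) (a l : K)

/-! ### Iterates of `σ` on `S ⊗_K S` and evaluation of the coaction at points -/

section

variable {K S : Type*} [Field K] [PhiSigmaRing K] [CommRing S] [PhiSigmaRing S] [Algebra K S]
  [PhiSigmaAlgebra K S]

theorem sigmaSelf_iterate_tmul (j : ℕ) (s t : S) : (sigmaSelf K S)^[j] (s ⊗ₜ t) =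
    (sigma : S →+* S)^[j] s ⊗ₜ (sigma : S →+* S)^[j] t := by
  induction j with
  | zero => rfl
  | succ j ih =>
    rw [Function.iterate_succ_apply', ih, Function.iterate_succ_apply',
      Function.iterate_succ_apply']
    exact tensorMap_tmul _ _ _ _ _ _ _

theorem sigmaSelf_iterate_smul (j : ℕ) (s : S) (z : S ⊗[K] S) : (sigmaSelf K S)^[j] (s • z) =
    (sigma : S →+* S)^[j] s • (sigmaSelf K S)^[j] z := by
  have h : ∀ (s : S) (z : S ⊗[K] S), s • z = (s ⊗ₜ 1) * z := fun s z => by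
    rw [Algebra.smul_def]; rfl
  rw [h, h, iterate_map_mul, sigmaSelf_iterate_tmul, iterate_map_one]

theorem sigmaSelf_iterate_sum_smul (j : ℕ) {ι : Type*} (t : Finset ι) (s : ι → S)
    (c : ι → S ⊗[K] S) : (sigmaSelf K S)^[j] (∑ i ∈ t, s i • c i) =
      ∑ i ∈ t, (sigma : S →+* S)^[j] (s i) • (sigmaSelf K S)^[j] (c i) := by
  rw [← RingHom.coe_pow, map_sum, RingHom.coe_pow]
  simp only [sigmaSelf_iterate_smul]

theorem sigmaSelf_iterate_mem_coordinateRing (j : ℕ) {z : S ⊗[K] S}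
    (hz : z ∈ coordinateRing K S) : (sigmaSelf K S)^[j] z ∈ coordinateRing K S := by
  induction j with
  | zero => exact hz
  | succ j ih =>
    rw [Function.iterate_succ_apply']
    change phiSelf K S (sigmaSelf K S _) = sigmaSelf K S _
    rw [phiSelf_sigmaSelf]
    exact congrArg _ ih

theorem sigmaSelf_iterate_mem_closure (j : ℕ) {z : S ⊗[K] S} {S₀ : Subalgebra K S}
    (hz : z ∈ AddSubmonoid.closure {y | ∃ a : S, ∃ t ∈ S₀, y = a ⊗ₜ[K] t}) :
    (sigmaSelf K S)^[j] z ∈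
      AddSubmonoid.closure {y | ∃ a : S, ∃ t ∈ S₀, y = a ⊗ₜ[K] (sigma : S →+* S)^[j] t} := by
  induction hz using AddSubmonoid.closure_induction with
  | mem x hx =>
    obtain ⟨a, t, ht, rfl⟩ := hx
    rw [sigmaSelf_iterate_tmul]
    exact AddSubmonoid.subset_closure ⟨_, t, ht, rfl⟩
  | zero => rw [iterate_map_zero]; exact zero_mem _
  | add x y _ _ hx hy => rw [iterate_map_add]; exact add_mem hx hy

/-- A `σ`-preimage in `K` of a constant is constant, because `σ` is injective and commutes with `φ`.
-/
theorem constants_sigma_surjective (hσK : Function.Surjective (sigma : K →+* K)) :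
    Function.Surjective (sigma : constants K →+* constants K) := by
  intro c
  obtain ⟨a, ha⟩ := hσK c
  refine ⟨⟨a, ?_⟩, Subtype.ext ha⟩
  change phi a = a
  apply (sigma : K →+* K).injective
  rw [← phi_sigma, ha]
  exact c.2

theorem sigmaSelf_injective (hσK : Function.Surjective (sigma : K →+* K))
    (hσS : Function.Injective (sigma : S →+* S)) : Function.Injective (sigmaSelf K S) :=
  tensorMap_injective _ _ _ _ _ hσK hσS hσS

theorem LinearIndependent.sigmaSelf_iterate (hσK : Function.Surjective (sigma : K →+* K))
    (hσS : Function.Injective (sigma : S →+* S)) {ι : Type*} {c : ι → S ⊗[K] S}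
    (hc : LinearIndependent (constants K) c) (j : ℕ) :
    LinearIndependent (constants K) (fun i => (sigmaSelf K S)^[j] (c i)) := by
  rw [linearIndependent_iff']
  intro t g hg i hi
  choose g' hg' using fun i => (constants_sigma_surjective hσK).iterate j (g i)
  have h1 : (sigmaSelf K S)^[j] (∑ i ∈ t, g' i • c i) = 0 := by
    rw [← hg]
    simp only [constants_smul_eq]
    rw [sigmaSelf_iterate_sum_smul]
    refine Finset.sum_congr rfl fun l _ => ?_
    rw [sigma_iterate_algebraMap, ← constants_sigma_iterate_coe, hg']
  have h2 : ∑ i ∈ t, g' i • c i = 0 :=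
    (sigmaSelf_injective hσK hσS).iterate j (by rw [h1, iterate_map_zero])
  rw [← hg', linearIndependent_iff'.1 hc t g' h2 i hi, iterate_map_zero]

theorem sum_smul_sigmaSelf_iterate_mem_closure {S₀ : Subalgebra K S} {r : ℕ}
    (a : Fin r → constants K) {c : Fin r → S ⊗[K] S}
    (hc : ∀ i, c i ∈ AddSubmonoid.closure {y | ∃ a : S, ∃ t ∈ S₀, y = a ⊗ₜ[K] t}) (j : ℕ) :
    ∑ i, a i • (sigmaSelf K S)^[j] (c i) ∈
      AddSubmonoid.closure {y | ∃ a : S, ∃ t ∈ S₀, y = a ⊗ₜ[K] (sigma : S →+* S)^[j] t} := by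
  refine sum_mem fun i _ => ?_
  rw [constants_smul_eq]
  exact smul_mem_closure_tmul _ (sigmaSelf_iterate_mem_closure j (hc i))

/-- One finitely generated `S₀` carries all the `c i`, so nontrivial combinations of the `σʲ(cᵢ)`
are nonzero elements of `S ⊗ σʲ(S₀)`. The constant `m` depends only on `S₀` and precedes `A`, whose
size is later chosen in terms of `m`. -/
theorem exists_points_linearIndependent [CharZero K] [IsDomain S]
    [IsAlgClosed (constants K)] (hσK : Function.Surjective (sigma : K →+* K))
    (hσS : Function.Injective (sigma : S →+* S)) {r : ℕ} (c : Fin r → coordinateAlgebra K S)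
    (hc : LinearIndependent (constants K) c) :
    ∃ m : ℕ, ∀ A : Finset ℕ, ∃ R₁ ≤ coordinateAlgebra K S, ∃ c₁ : ℕ → Fin r → R₁,
      (∀ j ∈ A, ∀ i, (c₁ j i : S ⊗[K] S) = (sigmaSelf K S)^[j] (c i)) ∧
      ∃ A' ⊆ A, A.card ≤ m ^ r * A'.card ∧ ∃ g : Fin r → (R₁ →ₐ[constants K] constants K),
        ∀ j ∈ A', LinearIndependent (constants K) (fun l i => g l (c₁ j i)) := by
  classical
  let cj : ℕ → Fin r → S ⊗[K] S := fun j i => (sigmaSelf K S)^[j] (c i)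
  have hcj : ∀ j, LinearIndependent (constants K) (cj j) := fun j =>
    LinearIndependent.sigmaSelf_iterate hσK hσS
      (hc.map' (coordinateAlgebra K S).val.toLinearMap
        (LinearMap.ker_eq_bot.2 Subtype.val_injective)) j
  obtain ⟨S₀, hS₀, hcS₀⟩ := exists_fg_mem_closure_tmul fun i => (c i : S ⊗[K] S)
  let κ : K ≃+* K := RingEquiv.ofBijective sigma ⟨(sigma : K →+* K).injective, hσK⟩
  obtain ⟨m, hm⟩ := exists_many_not_isNilpotent_prod κ sigma hσS
    (fun a => SigmaAlgebra.sigma_algebraMap a) S₀ hS₀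
  refine ⟨m, fun A => exists_subalgebra_algHoms_linearIndependent cj (coordinateAlgebra K S)
    (fun j i => sigmaSelf_iterate_mem_coordinateRing j (c i).2) A ?_⟩
  intro B hB a ha
  refine hm B (fun j => ∑ i, a j i • cj j i) ?_ ?_
  · intro j hj h0
    exact ha j hj (funext fun i =>
      linearIndependent_iff'.1 (hcj j) Finset.univ (a j) h0 i (Finset.mem_univ i))
  · exact fun j _ => sum_smul_sigmaSelf_iterate_mem_closure (a j) hcS₀ j

/-- The elements `∑ σʲ(sᵢ) ⊗ σʲ(cᵢ)` correspond to `1 ⊗ σʲ(b)` under the injective torsor map, so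
they satisfy the relation `p`, and `id ⊗ g` preserves it. No compatibility of `g` with `σ` enters,
since `p` is treated as an ordinary polynomial. -/
theorem aeval_coaction_eq_zero (htor : Function.Injective (torsorMap K S)) {r : ℕ}
    {s : Fin r → S} {c : Fin r → S ⊗[K] S} {b : S}
    (hexp : (1 : S) ⊗ₜ[K] b = ∑ i, s i • c i)
    {R₁ : Subalgebra (constants K) (S ⊗[K] S)} (hR₁ : R₁ ≤ coordinateAlgebra K S)
    {c₁ : ℕ → Fin r → R₁} {A' : Finset ℕ}
    (hc₁ : ∀ j ∈ A', ∀ i, (c₁ j i : S ⊗[K] S) = (sigmaSelf K S)^[j] (c i))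
    (g : R₁ →ₐ[constants K] constants K) (p : MvPolynomial A' K)
    (hp : MvPolynomial.aeval (fun j : A' => (sigma : S →+* S)^[j] b) p = 0) :
    MvPolynomial.aeval
      (fun j : A' => ∑ i, g (c₁ j i) • (sigma : S →+* S)^[j] (s i)) p = 0 := by
  let μ₁ : S ⊗[constants K] R₁ →ₐ[S] S ⊗[K] S := (torsorMap K S).comp
    (Algebra.TensorProduct.map (AlgHom.id S S) (Subalgebra.inclusion hR₁))
  have hμ₁ : Function.Injective μ₁ := htor.comp
    (Module.Flat.lTensor_preserves_injective_linearMap (M := S)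
      (Subalgebra.inclusion hR₁).toLinearMap (Subalgebra.inclusion_injective hR₁))
  let e : A' → S ⊗[constants K] R₁ := fun j => ∑ i, (sigma : S →+* S)^[j] (s i) ⊗ₜ c₁ j i
  have hμe : ∀ j : A', μ₁ (e j) = 1 ⊗ₜ (sigma : S →+* S)^[j] b := by
    intro j
    have h1 : (1 : S) ⊗ₜ[K] (sigma : S →+* S)^[j] b = (sigmaSelf K S)^[j] (1 ⊗ₜ b) := by
      rw [sigmaSelf_iterate_tmul, iterate_map_one]
    rw [h1, hexp, sigmaSelf_iterate_sum_smul, map_sum]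
    refine Finset.sum_congr rfl fun i _ => ?_
    change torsorMap K S ((sigma : S →+* S)^[j] (s i) ⊗ₜ Subalgebra.inclusion hR₁ (c₁ j i)) = _
    rw [torsorMap_tmul]
    exact congrArg _ (hc₁ j j.2 i)
  let Φ : S ⊗[constants K] R₁ →ₐ[S] S := Algebra.TensorProduct.lift (AlgHom.id S S)
    ((Algebra.ofId (constants K) S).comp g) fun _ _ => .all _ _
  have h1 : MvPolynomial.aeval e p = 0 := by
    apply hμ₁
    have h2 := MvPolynomial.comp_aeval_apply e (μ₁.restrictScalars K) p
    have h3 := MvPolynomial.comp_aeval_apply (fun j : A' => (sigma : S →+* S)^[j] b)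
      (Algebra.TensorProduct.includeRight : S →ₐ[K] S ⊗[K] S) p
    rw [hp, map_zero] at h3
    rw [map_zero]
    refine h2.trans (Eq.trans ?_ h3.symm)
    congr 2
    exact funext hμe
  have h2 := MvPolynomial.comp_aeval_apply e (Φ.restrictScalars K) p
  rw [h1, map_zero] at h2
  rw [h2]
  congr 2
  funext j
  change _ = Φ (e j)
  simp only [e, map_sum, Φ]
  refine Finset.sum_congr rfl fun i _ => ?_
  simp [Algebra.smul_def, Algebra.ofId_apply, mul_comm]
open AlgebraicIndependent in
theorem mem_sigmaAlgebraicElements_of_tmul_eq_sum [CharZero K] [IsDomain S]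
    [IsAlgClosed (constants K)] (hσK : Function.Surjective (sigma : K →+* K))
    (hσS : Function.Injective (sigma : S →+* S)) (htor : Function.Injective (torsorMap K S))
    {r : ℕ} (s : Fin r → S) (c : Fin r → coordinateAlgebra K S)
    (hc : LinearIndependent (constants K) c) {b : S} (hb : b ∈ sigmaAlgebraicElements K S)
    (hexp : (1 : S) ⊗ₜ[K] b = ∑ i, s i • (c i : S ⊗[K] S)) (i₀ : Fin r) :
    s i₀ ∈ sigmaAlgebraicElements K S := by
  obtain ⟨N, hN⟩ := ENat.ne_top_iff_exists.1 ((mem_sigmaAlgebraicElements_iff hσS).1 hb).ne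
  obtain ⟨m, hm⟩ := exists_points_linearIndependent hσK hσS c hc
  -- The size `mʳ · rN + 1` forces `|A'| > rN`, while the `r` families `ψ l`, each of rank at most
  -- `N`, generate `σʲ(s i₀)` for all `j ∈ A'`.
  obtain ⟨R₁, hR₁, c₁, hc₁, A', hA', hcard, g, hg⟩ := hm (Finset.range (m ^ r * (r * N) + 1))
  let ψ : Fin r → ℕ → S := fun l j => ∑ i, g l (c₁ j i) • (sigma : S →+* S)^[j] (s i)
  have hrel : ∀ l, ∀ p : MvPolynomial A' K,
      MvPolynomial.aeval (fun j : A' => (sigma : S →+* S)^[j] b) p = 0 →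
        MvPolynomial.aeval (fun j : A' => ψ l j) p = 0 := fun l p hp =>
    aeval_coaction_eq_zero htor hexp hR₁ (fun j hj => hc₁ j (hA' hj)) (g l) p hp
  have hmem : ∀ j ∈ A', (sigma : S →+* S)^[j] (s i₀) ∈
      Algebra.adjoin K (⋃ l, Set.range fun j : A' => ψ l j) := by
    intro j hj
    refine Algebra.adjoin_mono ?_ (sigma_iterate_mem_adjoin_coaction s j _ (hg j hj) i₀)
    rintro _ ⟨l, rfl⟩
    have h1 : ψ l j ∈ Set.range fun j : A' => ψ l j := ⟨⟨j, hj⟩, rfl⟩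
    exact Set.mem_iUnion_of_mem l h1
  by_contra hnot
  rw [mem_sigmaAlgebraicElements_iff_not_algebraicIndependent, not_not] at hnot
  have hind : AlgebraicIndependent K (fun j : A' => (sigma : S →+* S)^[j] (s i₀)) :=
    hnot.comp _ Subtype.val_injective
  have hle : (A'.card : ℕ∞) ≤ (r * N : ℕ) := by
    calc (A'.card : ℕ∞)
        = (Set.range fun j : A' => (sigma : S →+* S)^[j] (s i₀)).encard := by
          rw [← Set.image_univ, hind.injective.encard_image]
          simp
      _ = (matroid K S).eRk (Set.range fun j : A' => (sigma : S →+* S)^[j] (s i₀)) :=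
          ((matroid_indep_iff).2 hind.coe_range).eRk_eq_encard.symm
      _ ≤ (matroid K S).eRk ((matroid K S).closure (⋃ l, Set.range fun j : A' => ψ l j)) := by
          refine (matroid K S).eRk_mono ?_
          rintro _ ⟨j, rfl⟩
          exact subset_matroid_closure_adjoin _ (hmem j j.2)
      _ = (matroid K S).eRk (⋃ l, Set.range fun j : A' => ψ l j) := Matroid.eRk_closure_eq _ _
      _ ≤ r * N := by
          refine eRk_iUnion_le _ _ _ fun l => ?_
          refine (eRk_range_le_of_relations (hrel l)).trans ?_
          rw [hN]
          refine (matroid K S).eRk_mono ?_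
          rintro _ ⟨j, rfl⟩
          exact ⟨j, rfl⟩
      _ = (r * N : ℕ) := by push_cast; rfl
  have hle' : A'.card ≤ r * N := by exact_mod_cast hle
  rw [Finset.card_range] at hcard
  have h6 := Nat.mul_le_mul_left (m ^ r) hle'
  omega

end

/-! ### The torsor map is bijective -/

/-- Invariants of a module with a semilinear operator over a simple difference ring are linearly
independent as soon as they are so over the constants. -/
theorem linearIndependent_of_isPhiSimple {C L Z ι : Type*} [Field C] [CommRing L] [Algebra C L]
    {φ : L →+* L} (hL : IsPhiSimple L φ)
    (hconst : ∀ x, φ x = x → ∃ c : C, algebraMap C L c = x) [AddCommGroup Z] [Module L Z]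
    [Module C Z] [IsScalarTower C L Z] (Φ : Z →+ Z) (hΦ : ∀ (l : L) z, Φ (l • z) = φ l • Φ z)
    {c : ι → Z} (hc : ∀ i, Φ (c i) = c i) (hli : LinearIndependent C c) :
    LinearIndependent L c := by
  classical
  rw [linearIndependent_iff']
  intro s
  induction s using Finset.induction_on with
  | empty => simp
  | insert a s ha ih =>
    intro g hg
    -- The possible coefficients at `c a` in relations supported on `insert a s` form a `φ`-stable
    -- ideal.
    let I : Ideal L :=
      { carrier := {l | ∃ f : ι → L, l • c a + ∑ i ∈ s, f i • c i = 0}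
        zero_mem' := ⟨0, by simp⟩
        add_mem' := by
          rintro x y ⟨f, hf⟩ ⟨f', hf'⟩
          refine ⟨f + f', ?_⟩
          simp only [Pi.add_apply, add_smul, Finset.sum_add_distrib]
          rw [add_add_add_comm, hf, hf', add_zero]
        smul_mem' := by
          rintro l x ⟨f, hf⟩
          refine ⟨fun i => l * f i, ?_⟩
          simp only [smul_eq_mul, mul_smul]
          rw [← Finset.smul_sum, ← smul_add, hf, smul_zero] }
    have hI : ∀ x ∈ I, φ x ∈ I := by
      rintro x ⟨f, hf⟩
      refine ⟨fun i => φ (f i), ?_⟩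
      have := congrArg Φ hf
      rw [map_add, map_sum, map_zero, hΦ, hc] at this
      simpa only [hΦ, hc] using this
    rw [Finset.sum_insert ha] at hg
    rcases hL.2 I hI with h | h
    · have h0 : g a = 0 := by
        have : g a ∈ I := ⟨g, hg⟩
        rwa [h] at this
      rw [h0, zero_smul, zero_add] at hg
      intro i hi
      rcases Finset.mem_insert.1 hi with rfl | hi
      · exact h0
      · exact ih g hg i hi
    · exfalso
      obtain ⟨f, hf⟩ : (1 : L) ∈ I := h ▸ Submodule.mem_top
      have h1 := congrArg Φ hf
      rw [map_add, map_sum, map_zero, hΦ, hc, map_one] at h1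
      simp only [hΦ, hc] at h1
      -- Subtracting a relation with leading coefficient `1` from its `φ`-image removes `c a`. By
      -- induction the other coefficients are `φ`-invariant, hence in `C`, against independence over
      -- `C`.
      have h2 : ∑ i ∈ s, (φ (f i) - f i) • c i = 0 := by
        simp only [sub_smul, Finset.sum_sub_distrib]
        rw [← add_left_cancel_iff (a := (1 : L) • c a), add_zero, add_sub, h1, zero_sub,
          eq_comm, ← add_eq_zero_iff_eq_neg]
        exact hf
      have h3 : ∀ i ∈ s, ∃ x : C, algebraMap C L x = f i := fun i hi =>
        hconst _ (sub_eq_zero.1 (ih _ h2 i hi))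
      choose! x hx using h3
      have h4 : ∑ i ∈ insert a s, (if i = a then 1 else x i) • c i = 0 := by
        rw [Finset.sum_insert ha, if_pos rfl, one_smul]
        rw [one_smul] at hf
        rw [← hf]
        congr 1
        refine Finset.sum_congr rfl fun i hi => ?_
        rw [if_neg (by rintro rfl; exact ha hi), ← hx i hi, algebraMap_smul]
      have h5 := linearIndependent_iff'.1 hli _ _ h4 a (Finset.mem_insert_self a s)
      rw [if_pos rfl] at h5
      exact one_ne_zero h5

section

variable {K S : Type*} [Field K] [PhiSigmaRing K] [CommRing S] [PhiSigmaRing S] [Algebra K S]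
  [PhiSigmaAlgebra K S]

/-- Base change along a residue field `S ⧸ m` turns the torsor isomorphism into `(S ⧸ m) ⊗_K S ≅ (S
⧸ m) ⊗_C C{G}`. The right side is a domain because `C` is algebraically closed, and `S` embeds in
the left side. -/
theorem isDomain_of_torsorMap_bijective [Nontrivial S] [IsAlgClosed (constants K)]
    (h : Function.Bijective (torsorMap K S)) (hR : IsDomain (coordinateRing K S)) :
    IsDomain S := by
  obtain ⟨m, hm⟩ := Ideal.exists_maximal S
  let _ : Field (S ⧸ m) := Ideal.Quotient.field m
  have hR' : IsDomain (coordinateAlgebra K S) := hR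
  have : IsDomain ((S ⧸ m) ⊗[constants K] coordinateAlgebra K S) := isDomain_tensorProduct
  let e₁ := Algebra.TensorProduct.cancelBaseChange K S S (S ⧸ m) S
  let e₂ := Algebra.TensorProduct.cancelBaseChange (constants K) S S (S ⧸ m) (coordinateAlgebra K S)
  let e₃ := Algebra.TensorProduct.congr (AlgEquiv.refl (R := S) (A₁ := S ⧸ m))
    (AlgEquiv.ofBijective (torsorMap K S) h)
  let f : S →+* (S ⧸ m) ⊗[constants K] coordinateAlgebra K S :=
    (e₂.toRingEquiv.toRingHom.comp
      (e₃.symm.toRingEquiv.toRingHom.comp e₁.symm.toRingEquiv.toRingHom)).comp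
      (Algebra.TensorProduct.includeRight : S →ₐ[K] (S ⧸ m) ⊗[K] S).toRingHom
  have hf : Function.Injective f :=
    (e₂.injective.comp (e₃.symm.injective.comp e₁.symm.injective)).comp
      (Algebra.TensorProduct.includeRight_injective (algebraMap K (S ⧸ m)).injective)
  exact hf.isDomain f

/-- In a `C`-basis of `B`, `φ` acts on the coefficients, so those of an invariant element are
constants. -/
theorem exists_eq_one_tmul_of_phiBase_eq
    (hconst : ∀ x : S, phi x = x → ∃ c : K, phi c = c ∧ algebraMap K S c = x)
    {B : Type*} [CommRing B] [SigmaRing B] [Algebra (constants K) B]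
    [SigmaAlgebra (constants K) B] {x : S ⊗[constants K] B} (hx : phiBase K S B x = x) :
    ∃ β : B, x = 1 ⊗ₜ β := by
  have hpb : ∀ (s : S) (β : B), phiBase K S B (s ⊗ₜ β) = phi s ⊗ₜ β := fun s β =>
    tensorMap_tmul _ _ _ _ _ _ _
  let b := Module.Free.chooseBasis (constants K) B
  obtain ⟨f, rfl⟩ := TensorProduct.eq_repr_basis_right b x
  have h1 : ∑ i ∈ f.support, (phi (f i) - f i) ⊗ₜ[constants K] b i = 0 := by
    simp only [TensorProduct.sub_tmul, Finset.sum_sub_distrib]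
    rw [sub_eq_zero]
    refine Eq.trans ?_ hx
    rw [Finsupp.sum, map_sum]
    exact Finset.sum_congr rfl fun i _ => (hpb _ _).symm
  have h2 : ∑ i ∈ f.support, b i ⊗ₜ[constants K] (phi (f i) - f i) = 0 := by
    have := congrArg (TensorProduct.comm (constants K) S B) h1
    simpa using this
  have h3 := b.linearIndependent.eq_zero_of_sum_tmul h2
  have h4 : ∀ i ∈ f.support, ∃ c : constants K, f i = c • (1 : S) := by
    intro i hi
    obtain ⟨c, hc, hc'⟩ := hconst _ (sub_eq_zero.1 (h3 i hi))
    exact ⟨⟨c, hc⟩, by rw [← hc', Algebra.smul_def, mul_one]; rfl⟩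
  choose! c hc using h4
  refine ⟨∑ i ∈ f.support, c i • b i, ?_⟩
  rw [TensorProduct.tmul_sum, Finsupp.sum]
  refine Finset.sum_congr rfl fun i hi => ?_
  rw [TensorProduct.tmul_smul, TensorProduct.smul_tmul', ← hc i hi]

theorem exists_tmul_eq_sum_of_mem_range {b : S}
    (hb : (1 : S) ⊗ₜ[K] b ∈ Set.range (torsorMap K S)) :
    ∃ (r : ℕ) (s : Fin r → S) (c : Fin r → coordinateAlgebra K S),
      LinearIndependent (constants K) c ∧
        (1 : S) ⊗ₜ[K] b = ∑ i, s i • (c i : S ⊗[K] S) := by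
  obtain ⟨z, hz⟩ := hb
  let β := Module.Free.chooseBasis (constants K) (coordinateAlgebra K S)
  obtain ⟨f, rfl⟩ := TensorProduct.eq_repr_basis_right β z
  let e := f.support.equivFin.symm
  refine ⟨f.support.card, fun i => f (e i), fun i => β (e i), ?_, ?_⟩
  · exact β.linearIndependent.comp _ (Subtype.val_injective.comp e.injective)
  · rw [← hz, Finsupp.sum, map_sum, ← Finset.sum_coe_sort f.support, ← e.sum_comp]
    exact Finset.sum_congr rfl fun i _ => torsorMap_tmul _ _ _ _

end

/-- The automorphism `τ` induces an `S`-algebra map `F : S ⊗_K S → S ⊗_C B` commuting with `φ`,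
which therefore sends `C{G}` into `1 ⊗ B`. Applied to `1 ⊗ m = ∑ sᵢ cᵢ` it gives `τ(m ⊗ 1) = ∑ sᵢ ⊗
γᵢ`, with `σ`-algebraic `sᵢ`. -/
theorem isGaloisStable_of_torsor.{x, y, z} {K : Type x} {S : Type y} [Field K] [PhiSigmaRing K]
    [CommRing S] [PhiSigmaRing S] [Algebra K S] [PhiSigmaAlgebra K S]
    [CharZero K] [IsDomain S] [IsAlgClosed (constants K)]
    (hσK : Function.Surjective (sigma : K →+* K))
    (hσS : Function.Injective (sigma : S →+* S))
    (hconst : ∀ x : S, phi x = x → ∃ c : K, phi c = c ∧ algebraMap K S c = x)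
    (htor : Function.Injective (torsorMap K S))
    (hgen : ∀ b : S, (1 : S) ⊗ₜ[K] b ∈ Set.range (torsorMap K S)) :
    IsGaloisStable.{x, y, z} K (sigmaAlgebraicSubalgebra K S hσS) := by
  intro B _ _ _ _ τ hτ x hx
  obtain ⟨hτ1, hτ2, -⟩ := hτ
  have hmem : ∀ m ∈ sigmaAlgebraicElements K S, ∀ β : B,
      m ⊗ₜ[constants K] β ∈ baseChange K B (sigmaAlgebraicSubalgebra K S hσS) := fun m hm β =>
    ⟨(⟨m, hm⟩ : sigmaAlgebraicSubalgebra K S hσS) ⊗ₜ β, rfl⟩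
  let g : S →ₐ[K] S ⊗[constants K] B :=
    { (τ : S ⊗[constants K] B →+* S ⊗[constants K] B).comp
        (Algebra.TensorProduct.includeLeft : S →ₐ[S] S ⊗[constants K] B).toRingHom with
      commutes' := fun a => hτ1 a 1 }
  have hg : ∀ s, g s = τ (s ⊗ₜ 1) := fun _ => rfl
  let F : S ⊗[K] S →ₐ[S] S ⊗[constants K] B :=
    Algebra.TensorProduct.lift (Algebra.ofId S _) g fun _ _ => .all _ _
  have hF : ∀ s t, F (s ⊗ₜ t) = (s ⊗ₜ 1) * τ (t ⊗ₜ 1) := fun s t => rfl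
  have hpb : ∀ (s : S) (β : B), phiBase K S B (s ⊗ₜ β) = phi s ⊗ₜ β := fun s β =>
    tensorMap_tmul _ _ _ _ _ _ _
  have hFφ : ∀ z, F (phiSelf K S z) = phiBase K S B (F z) := by
    intro z
    induction z with
    | zero => simp
    | add x y hx hy => simp only [map_add, hx, hy]
    | tmul s t =>
      rw [hF, map_mul, ← hτ2, hpb, hpb]
      have : phiSelf K S (s ⊗ₜ t) = phi s ⊗ₜ phi t := tensorMap_tmul _ _ _ _ _ _ _
      rw [this, hF]
  have hcoord : ∀ c : coordinateAlgebra K S, ∃ β : B, F c = 1 ⊗ₜ β := fun c =>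
    exists_eq_one_tmul_of_phiBase_eq hconst (by rw [← hFφ]; exact congrArg F c.2)
  have hone : ∀ m ∈ sigmaAlgebraicElements K S, ∀ β : B,
      τ (m ⊗ₜ 1) * (1 ⊗ₜ β) ∈ baseChange K B (sigmaAlgebraicSubalgebra K S hσS) := by
    intro m hm β
    obtain ⟨r, s, c, hc, hexp⟩ := exists_tmul_eq_sum_of_mem_range (hgen m)
    choose γ hγ using fun i => hcoord (c i)
    have h1 : τ (m ⊗ₜ 1) = ∑ i, s i ⊗ₜ γ i := by
      have : τ (m ⊗ₜ 1) = F (1 ⊗ₜ m) := by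
        rw [hF, ← Algebra.TensorProduct.one_def, one_mul]
      rw [this, hexp, map_sum]
      refine Finset.sum_congr rfl fun i _ => ?_
      rw [map_smul, hγ, TensorProduct.smul_tmul', smul_eq_mul, mul_one]
    rw [h1, Finset.sum_mul]
    refine Submodule.sum_mem _ fun i _ => ?_
    rw [Algebra.TensorProduct.tmul_mul_tmul, mul_one]
    exact hmem _ (mem_sigmaAlgebraicElements_of_tmul_eq_sum hσK hσS htor s c hc hm hexp i) _
  let ρ : sigmaAlgebraicSubalgebra K S hσS ⊗[constants K] B →+ S ⊗[constants K] B :=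
    (LinearMap.rTensor B ((Subalgebra.toSubmodule
      (sigmaAlgebraicSubalgebra K S hσS)).restrictScalars (constants K)).subtype).toAddMonoidHom
  have hρ : ∀ y, τ (ρ y) ∈ baseChange K B (sigmaAlgebraicSubalgebra K S hσS) := by
    intro y
    induction y with
    | zero =>
      rw [map_zero, map_zero]
      exact Submodule.zero_mem _
    | add x y hx hy =>
      rw [map_add, map_add]
      exact Submodule.add_mem _ hx hy
    | tmul m β =>
      have h1 : τ ((1 : S) ⊗ₜ β) = 1 ⊗ₜ β := by
        have := hτ1 1 β
        rwa [map_one] at this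
      have h2 : (m : S) ⊗ₜ[constants K] β = ((m : S) ⊗ₜ 1) * (1 ⊗ₜ β) := by
        rw [Algebra.TensorProduct.tmul_mul_tmul, mul_one, one_mul]
      have h3 : τ ((m : S) ⊗ₜ β) ∈ baseChange K B (sigmaAlgebraicSubalgebra K S hσS) := by
        rw [h2, map_mul, h1]
        exact hone m m.2 β
      exact h3
  obtain ⟨y, rfl⟩ := hx
  exact hρ y

/-- The kernel of `σ` is a proper `φ`-stable ideal. -/
theorem sigma_injective_of_isPhiSimple {L : Type*} [CommRing L] [PhiSigmaRing L]
    (h : IsPhiSimple L phi) : Function.Injective (sigma : L →+* L) := by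
  have := h.1
  rw [RingHom.injective_iff_ker_eq_bot]
  refine (h.2 _ fun x hx => ?_).resolve_right (RingHom.ker_ne_top _)
  rw [RingHom.mem_ker] at hx ⊢
  rw [← phi_sigma, hx, map_zero]

/-- Simplicity is available for `L` rather than for `S`. So `S ⊗_K S` is embedded in `L ⊗_K S`,
where `φ`-invariants that are independent over `C` stay independent over `L`. -/
theorem torsorMap_injective {K S L : Type*} [Field K] [PhiSigmaRing K] [CommRing S]
    [PhiSigmaRing S] [Algebra K S] [PhiSigmaAlgebra K S] [CommRing L] [PhiSigmaRing L]
    [Algebra K L] [PhiSigmaAlgebra K L] (hL : IsPhiSimple L phi)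
    (hconst : ∀ x : L, phi x = x → ∃ c : K, phi c = c ∧ algebraMap K L c = x)
    (j : S →ₐ[K] L) (hj : Function.Injective j) (hjφ : ∀ x, j (phi x) = phi (j x)) :
    Function.Injective (torsorMap K S) := by
  let J : S ⊗[K] S →ₐ[K] L ⊗[K] S := Algebra.TensorProduct.map j (AlgHom.id K S)
  have hJ : Function.Injective J :=
    Module.Flat.rTensor_preserves_injective_linearMap (M := S) j.toLinearMap hj
  let Φ : L ⊗[K] S →+* L ⊗[K] S :=
    tensorMap phi phi phi PhiSigmaAlgebra.phi_algebraMap PhiSigmaAlgebra.phi_algebraMap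
  have hΦt : ∀ l s, Φ (l ⊗ₜ s) = phi l ⊗ₜ phi s := fun l s => tensorMap_tmul _ _ _ _ _ _ _
  have hΦJ : ∀ z, Φ (J z) = J (phiSelf K S z) := by
    intro z
    induction z with
    | zero => simp only [map_zero]
    | add x y hx hy => simp only [map_add, hx, hy]
    | tmul s t =>
      have : phiSelf K S (s ⊗ₜ t) = phi s ⊗ₜ phi t := tensorMap_tmul _ _ _ _ _ _ _
      rw [this, Algebra.TensorProduct.map_tmul, Algebra.TensorProduct.map_tmul, hΦt, hjφ]
      rfl
  have hJs : ∀ (s : S) z, J (s • z) = j s • J z := by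
    intro s z
    induction z with
    | zero => simp only [map_zero, smul_zero]
    | add x y hx hy => simp only [smul_add, map_add, hx, hy]
    | tmul a b =>
      rw [TensorProduct.smul_tmul', Algebra.TensorProduct.map_tmul,
        Algebra.TensorProduct.map_tmul, TensorProduct.smul_tmul', smul_eq_mul, smul_eq_mul, map_mul]
  have hΦs : ∀ (l : L) z, Φ (l • z) = phi l • Φ z := by
    intro l z
    induction z with
    | zero => simp only [map_zero, smul_zero]
    | add x y hx hy => simp only [smul_add, map_add, hx, hy]
    | tmul a b =>
      rw [TensorProduct.smul_tmul', hΦt, hΦt, TensorProduct.smul_tmul', smul_eq_mul, smul_eq_mul,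
        map_mul]
  let β := Module.Free.chooseBasis (constants K) (coordinateAlgebra K S)
  have hli : LinearIndependent (constants K) fun i => J (β i) :=
    β.linearIndependent.map_injOn ((J.toLinearMap.restrictScalars (constants K)) ∘ₗ
      (coordinateAlgebra K S).val.toLinearMap) (hJ.comp Subtype.val_injective).injOn
  have hli' : LinearIndependent L fun i => J (β i) :=
    linearIndependent_of_isPhiSimple (C := constants K) hL
      (fun x hx => by
        obtain ⟨c, hc, hcx⟩ := hconst x hx
        exact ⟨⟨c, hc⟩, hcx⟩)
      Φ.toAddMonoidHom hΦs (fun i => (hΦJ _).trans (congrArg J (β i).2)) hli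
  rw [injective_iff_map_eq_zero]
  intro z hz
  obtain ⟨f, rfl⟩ := TensorProduct.eq_repr_basis_right β z
  have h1 : ∑ i ∈ f.support, j (f i) • J (β i) = 0 := by
    rw [Finsupp.sum, map_sum] at hz
    have := congrArg J hz
    rw [map_sum, map_zero] at this
    rw [← this]
    exact Finset.sum_congr rfl fun i _ => by rw [torsorMap_tmul, hJs]
  refine Finset.sum_eq_zero fun i hi => ?_
  have h2 := linearIndependent_iff'.1 hli' _ _ h1 i hi
  change f i ⊗ₜ[constants K] β i = 0
  rw [(map_eq_zero_iff j hj).1 h2, TensorProduct.zero_tmul]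

/-! ### The image of the torsor map -/

section

variable {K S : Type*} [Field K] [PhiSigmaRing K] [CommRing S] [PhiSigmaRing S] [Algebra K S]
  [PhiSigmaAlgebra K S]

variable (K S) in
/-- The elements `x` of `S` for which `1 ⊗ x` lies in the image of the torsor map. -/
noncomputable def torsorSubalgebra : Subalgebra K S :=
  ((torsorMap K S).range.restrictScalars K).comap
    (Algebra.TensorProduct.includeRight : S →ₐ[K] S ⊗[K] S)

theorem mem_torsorSubalgebra {x : S} :
    x ∈ torsorSubalgebra K S ↔ (1 : S) ⊗ₜ[K] x ∈ (torsorMap K S).range :=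
  Iff.rfl

theorem sigmaSelf_mem_range_torsorMap {z : S ⊗[K] S} (hz : z ∈ (torsorMap K S).range) :
    sigmaSelf K S z ∈ (torsorMap K S).range := by
  obtain ⟨z, rfl⟩ := hz
  change sigmaSelf K S (torsorMap K S z) ∈ _
  induction z with
  | zero =>
    simp only [map_zero]
    exact Subalgebra.zero_mem _
  | add x y hx hy =>
    simp only [map_add]
    exact Subalgebra.add_mem _ hx hy
  | tmul s c =>
    rw [torsorMap_tmul]
    have h : sigmaSelf K S (s • (c : S ⊗[K] S)) = sigma s • sigmaSelf K S c :=
      sigmaSelf_iterate_smul 1 s _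
    rw [h]
    exact ⟨sigma s ⊗ₜ ⟨sigmaSelf K S c, sigmaSelf_iterate_mem_coordinateRing 1 c.2⟩,
      torsorMap_tmul _ _ _ _⟩

theorem sigma_mem_torsorSubalgebra {x : S} (hx : x ∈ torsorSubalgebra K S) :
    sigma x ∈ torsorSubalgebra K S := by
  have h := sigmaSelf_mem_range_torsorMap (mem_torsorSubalgebra.1 hx)
  have : sigmaSelf K S (1 ⊗ₜ x) = sigma 1 ⊗ₜ sigma x := tensorMap_tmul _ _ _ _ _ _ _
  rw [this, map_one] at h
  exact h

/-- The entries of an invertible matrix `u` with `φ(u) = Au` satisfy `1 ⊗ u = (u ⊗ 1) Z` with an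
invariant matrix `Z`. -/
theorem mem_torsorSubalgebra_of_phi_eq {n : Type*} [Fintype n] [DecidableEq n]
    {A : Matrix n n K} {u v : Matrix n n S} (huv : u * v = 1)
    (hu : u.map phi = A.map (algebraMap K S) * u) (i j : n) : u i j ∈ torsorSubalgebra K S := by
  -- This is `φ(v) = vA⁻¹`, in a form that avoids inverting `A`; it makes `(v ⊗ 1)(1 ⊗ u)`
  -- invariant.
  have hφv : v.map phi * A.map (algebraMap K S) = v := by
    have h1 : v.map phi * u.map phi = 1 := by
      rw [← Matrix.map_mul, mul_eq_one_comm.1 huv]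
      exact Matrix.map_one _ (map_zero _) (map_one _)
    rw [hu, ← mul_assoc] at h1
    calc _ = (v.map phi * A.map (algebraMap K S) * u) * v := by rw [mul_assoc, huv, mul_one]
      _ = v := by rw [h1, one_mul]
  let l : S →+* S ⊗[K] S := (Algebra.TensorProduct.includeLeft : S →ₐ[K] S ⊗[K] S).toRingHom
  let r : S →+* S ⊗[K] S := (Algebra.TensorProduct.includeRight : S →ₐ[K] S ⊗[K] S).toRingHom
  have hlr : ∀ a, l (algebraMap K S a) = r (algebraMap K S a) := fun a =>
    (AlgHom.commutes (Algebra.TensorProduct.includeLeft : S →ₐ[K] S ⊗[K] S) a).trans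
      (AlgHom.commutes (Algebra.TensorProduct.includeRight : S →ₐ[K] S ⊗[K] S) a).symm
  have hp : ∀ s t : S, phiSelf K S (s ⊗ₜ t) = phi s ⊗ₜ phi t := fun _ _ =>
    tensorMap_tmul _ _ _ _ _ _ _
  have hl : ∀ s, phiSelf K S (l s) = l (phi s) := fun s =>
    (hp s 1).trans (congrArg (phi s ⊗ₜ[K] ·) (map_one _))
  have hr : ∀ s, phiSelf K S (r s) = r (phi s) := fun s =>
    (hp 1 s).trans (congrArg (· ⊗ₜ[K] phi s) (map_one _))
  have hZ : (v.map l * u.map r).map (phiSelf K S) = v.map l * u.map r := by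
    have h1 : (v.map l).map (phiSelf K S) = (v.map phi).map l := by
      ext a b
      exact hl _
    have h2 : (u.map r).map (phiSelf K S) = (u.map phi).map r := by
      ext a b
      exact hr _
    have h3 : (A.map (algebraMap K S)).map r = (A.map (algebraMap K S)).map l := by
      ext a b
      exact (hlr _).symm
    rw [Matrix.map_mul, h1, h2, hu, Matrix.map_mul, h3, ← mul_assoc, ← Matrix.map_mul, hφv]
  have huZ : u.map r = u.map l * (v.map l * u.map r) := by
    rw [← mul_assoc, ← Matrix.map_mul, huv, Matrix.map_one _ (map_zero _) (map_one _), one_mul]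
  have h4 : (1 : S) ⊗ₜ[K] u i j = ∑ k, u i k • (v.map l * u.map r) k j := by
    refine (congrFun (congrFun huZ i) j).trans ?_
    rw [Matrix.mul_apply]
    exact Finset.sum_congr rfl fun k _ => (Algebra.smul_def (u i k) _).symm
  rw [mem_torsorSubalgebra, h4]
  refine Subalgebra.sum_mem _ fun k _ => Subalgebra.smul_mem _ ?_ _
  refine ⟨1 ⊗ₜ ⟨(v.map l * u.map r) k j, congrFun (congrFun hZ k) j⟩, ?_⟩
  exact (torsorMap_tmul _ _ _ _).trans (one_smul _ _)

theorem torsorMap_surjective (h : torsorSubalgebra K S = ⊤) :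
    Function.Surjective (torsorMap K S) := by
  intro z
  change z ∈ (torsorMap K S).range
  induction z with
  | zero => exact Subalgebra.zero_mem _
  | add x y hx hy => exact Subalgebra.add_mem _ hx hy
  | tmul s t =>
    have h1 : (1 : S) ⊗ₜ[K] t ∈ (torsorMap K S).range :=
      mem_torsorSubalgebra.1 (h ▸ Algebra.mem_top)
    have h2 : s ⊗ₜ[K] t = s • ((1 : S) ⊗ₜ[K] t) := by
      rw [TensorProduct.smul_tmul', smul_eq_mul, mul_one]
    rw [h2]
    exact Subalgebra.smul_mem _ h1 s

end

/-! ### The torsor isomorphism of a `σ`-Picard–Vessiot ring -/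

namespace SigmaPVExtension

variable {K : Type*} [Field K] [PhiSigmaRing K] {n : ℕ} {A : GL (Fin n) K}
  {L : Type*} [CommRing L] [PhiSigmaRing L] [Algebra K L] [PhiSigmaAlgebra K L]

theorem ring_nontrivial (P : SigmaPVExtension A L) : Nontrivial P.ring :=
  have := P.isPhiPseudoField.1.1
  inferInstance

theorem sigma_ring_injective (P : SigmaPVExtension A L) :
    Function.Injective (sigma : P.ring →+* P.ring) := fun _ _ h =>
  Subtype.ext (sigma_injective_of_isPhiSimple P.isPhiPseudoField.1 (congrArg Subtype.val h))

theorem exists_constant_of_phi_eq (P : SigmaPVExtension A L) (x : P.ring) (hx : phi x = x) :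
    ∃ c : K, phi c = c ∧ algebraMap K P.ring c = x := by
  obtain ⟨c, hc, hcx⟩ := P.constants_eq x (congrArg Subtype.val hx)
  exact ⟨c, hc, Subtype.ext hcx⟩

theorem torsorMap_ring_injective (P : SigmaPVExtension A L) :
    Function.Injective (torsorMap K P.ring) :=
  torsorMap_injective P.isPhiPseudoField.1 P.constants_eq P.ring.val Subtype.val_injective
    fun _ => rfl

/-- The torsor subalgebra is `σ`-stable, so only the `σ`-generators of the ring, the entries of `U`
and `1/det U`, have to be checked. -/
theorem torsorSubalgebra_ring (P : SigmaPVExtension A L) : torsorSubalgebra K P.ring = ⊤ := by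
  let u : Matrix (Fin n) (Fin n) P.ring := fun i j =>
    ⟨P.U.1 i j, subset_sigmaAdjoin K _ (Or.inl ⟨i, j, rfl⟩)⟩
  let d : P.ring := ⟨((Matrix.GeneralLinearGroup.det P.U)⁻¹ : Lˣ).1,
    subset_sigmaAdjoin K _ (Or.inr rfl)⟩
  have hd : u.det * d = 1 := by
    refine Subtype.ext ?_
    change P.ring.val u.det * ((Matrix.GeneralLinearGroup.det P.U)⁻¹ : Lˣ).1 = 1
    have : P.ring.val u.det = (Matrix.GeneralLinearGroup.det P.U : Lˣ).1 :=
      AlgHom.map_det P.ring.val u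
    rw [this, Units.mul_inv]
  have huv : u * (d • u.adjugate) = 1 := by
    rw [Matrix.mul_smul, Matrix.mul_adjugate, smul_smul, mul_comm, hd, one_smul]
  have hu : u.map phi = A.1.map (algebraMap K P.ring) * u := by
    ext i j
    refine (congrFun (congrFun P.phi_U i) j).trans ?_
    simp only [Matrix.mul_apply, AddSubmonoidClass.coe_finsetSum]
    rfl
  have hdet : phi u.det = algebraMap K P.ring A.1.det * u.det := by
    rw [RingHom.map_det, RingHom.mapMatrix_apply, hu, Matrix.det_mul, ← RingHom.mapMatrix_apply,
      ← RingHom.map_det]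
  have ha : algebraMap K P.ring A.1.det * algebraMap K P.ring (A.1.det)⁻¹ = 1 := by
    rw [← map_mul, mul_inv_cancel₀
      (show A.1.det ≠ 0 from (Matrix.GeneralLinearGroup.det A).ne_zero), map_one]
  have hφd : phi d = algebraMap K P.ring (A.1.det)⁻¹ * d := by
    have h1 : phi u.det * phi d = 1 := by rw [← map_mul, hd, map_one]
    rw [hdet] at h1
    linear_combination (algebraMap K P.ring (A.1.det)⁻¹ * d) * h1 - phi d * u.det * d * ha -
      phi d * hd
  have hdmem : d ∈ torsorSubalgebra K P.ring := by
    -- `1/det U` is a fundamental matrix of the `1 × 1` system with coefficient `1/det A`.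
    refine mem_torsorSubalgebra_of_phi_eq (A := Matrix.of fun _ _ : Unit => (A.1.det)⁻¹)
      (u := Matrix.of fun _ _ => d) (v := Matrix.of fun _ _ => u.det) ?_ ?_ () ()
    · refine Matrix.ext fun _ _ => ?_
      rw [Matrix.mul_apply, Fintype.sum_unique, Matrix.of_apply, Matrix.of_apply, mul_comm]
      exact hd
    · refine Matrix.ext fun _ _ => ?_
      rw [Matrix.mul_apply, Fintype.sum_unique]
      exact hφd
  have hle : P.ring ≤ (torsorSubalgebra K P.ring).map P.ring.val := by
    refine sigmaAdjoin_le K ?_ ?_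
    · rintro x (⟨i, j, rfl⟩ | hx)
      · exact ⟨u i j, mem_torsorSubalgebra_of_phi_eq huv hu i j, rfl⟩
      · rw [Set.mem_singleton_iff] at hx
        exact ⟨d, hdmem, hx.symm⟩
    · rintro _ ⟨x, hx, rfl⟩
      exact ⟨sigma x, sigma_mem_torsorSubalgebra hx, rfl⟩
  refine eq_top_iff.2 fun x _ => ?_
  obtain ⟨y, hy, hyx⟩ := hle x.2
  rwa [← Subtype.ext hyx]

theorem torsorMap_ring_bijective (P : SigmaPVExtension A L) :
    Function.Bijective (torsorMap K P.ring) :=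
  ⟨P.torsorMap_ring_injective, torsorMap_surjective P.torsorSubalgebra_ring⟩

end SigmaPVExtension

theorem SigmaPVExtension.isGaloisStable.{x, y, z} {K : Type x} [Field K] [PhiSigmaRing K] {n : ℕ}
    {A : GL (Fin n) K} {L : Type y} [CommRing L] [PhiSigmaRing L] [Algebra K L]
    [PhiSigmaAlgebra K L] (P : SigmaPVExtension A L) [CharZero K] [IsDomain P.ring]
    [IsAlgClosed (constants K)] (hσ : Function.Surjective (sigma : K →+* K)) :
    IsGaloisStable.{x, y, z} K (sigmaAlgebraicSubalgebra K P.ring P.sigma_ring_injective) :=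
  isGaloisStable_of_torsor hσ P.sigma_ring_injective P.exists_constant_of_phi_eq
    P.torsorMap_ring_injective fun _ => P.torsorMap_ring_bijective.2 _

/-! ### The base fields -/

section

theorem isAlgClosed_of_ringEquiv {F E : Type*} [Field F] [Field E] [IsAlgClosed F]
    (e : F ≃+* E) : IsAlgClosed E := by
  refine ⟨fun p => ?_⟩
  have h := (IsAlgClosed.splits (p.map e.symm.toRingHom)).map e.toRingHom
  rw [Polynomial.map_map] at h
  have he : e.toRingHom.comp e.symm.toRingHom = RingHom.id E :=
    RingHom.ext fun x => e.apply_symm_apply x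
  rwa [he, Polynomial.map_id] at h

variable {F E : Type*} [Field F] [Field E] [Algebra F E]

theorem mem_range_algebraMap_of_isAlgebraic [IsAlgClosed F] {x : E} (hx : IsAlgebraic F x) :
    x ∈ Set.range (algebraMap F E) :=
  minpoly.mem_range_of_degree_eq_one F x
    (IsAlgClosed.degree_eq_one_of_irreducible F (minpoly.irreducible hx.isIntegral))

open AlgebraicIndependent in
/-- An endomorphism with an infinite orbit `φᵏ(x)` has no fixed elements outside `F`, if the field
is algebraic over `F(x)`. -/
theorem mem_range_algebraMap_of_map_eq [IsAlgClosed F] {x : E}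
    (halg : ∀ y : E, IsAlgebraic (Algebra.adjoin F {x}) y) (φ : E →ₐ[F] E)
    (hφ : Function.Injective fun k : ℕ => φ^[k] x) {c : E} (hc : φ c = c) :
    c ∈ Set.range (algebraMap F E) := by
  by_contra hcF
  have hc1 : c ∈ (matroid F E).closure (insert x ∅) := by
    rw [insert_empty_eq, matroid_closure_eq]
    exact halg c
  have hc2 : c ∉ (matroid F E).closure ∅ := by
    rw [matroid_closure_eq]
    intro h
    have h' : IsAlgebraic (Algebra.adjoin F (∅ : Set E)) c := h
    have : Algebra.IsAlgebraic F (Algebra.adjoin F (∅ : Set E)) := by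
      rw [Algebra.adjoin_empty]
      refine ⟨fun ⟨y, hy⟩ => ?_⟩
      obtain ⟨a, rfl⟩ := Algebra.mem_bot.1 hy
      exact isAlgebraic_algebraMap (A := (⊥ : Subalgebra F E)) a
    exact hcF (mem_range_algebraMap_of_isAlgebraic (h'.restrictScalars F))
  -- A fixed `c` outside `F` is transcendental, so by exchange `x` is algebraic over `F[c]`. As `φ`
  -- fixes `F[c]`, the infinitely many `φᵏ(x)` would all be roots of one nonzero polynomial.
  have hx := ((matroid F E).closure_exchange ⟨hc1, hc2⟩).1
  rw [insert_empty_eq, matroid_closure_eq] at hx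
  obtain ⟨p, hp, hpx⟩ : IsAlgebraic (Algebra.adjoin F {c}) x := hx
  have hle : Algebra.adjoin F {c} ≤ AlgHom.equalizer φ (AlgHom.id F E) :=
    Algebra.adjoin_le (by simpa using hc)
  let φ' : E →ₐ[Algebra.adjoin F {c}] E := { φ.toRingHom with commutes' := fun a => hle a.2 }
  have hroot : ∀ k : ℕ, φ^[k] x ∈ p.rootSet E := by
    intro k
    rw [Polynomial.mem_rootSet_of_injective Subtype.val_injective hp]
    induction k with
    | zero => exact hpx
    | succ k ih =>
      rw [Function.iterate_succ_apply']
      exact (Polynomial.aeval_algHom_apply φ' _ p).trans ((congrArg φ' ih).trans (map_zero φ'))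
  exact (Set.infinite_range_of_injective hφ).mono (Set.range_subset_iff.2 hroot)
    (p.rootSet_finite E)

/-- The elements that are algebraic over `F[x]`. -/
def algebraicOverAdjoin (F : Type*) {E : Type*} [Field F] [Field E] [Algebra F E] (x : E) :
    IntermediateField F E :=
  { (Subalgebra.algebraicClosure (Algebra.adjoin F {x}) E).restrictScalars F with
    inv_mem' := fun _ h => IsAlgebraic.inv h }

theorem mem_algebraicOverAdjoin {x y : E} :
    y ∈ algebraicOverAdjoin F x ↔ IsAlgebraic (Algebra.adjoin F {x}) y := Iff.rfl

theorem self_mem_algebraicOverAdjoin (x : E) : x ∈ algebraicOverAdjoin F x :=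
  isAlgebraic_algebraMap (⟨x, Algebra.self_mem_adjoin_singleton F x⟩ : Algebra.adjoin F {x})

/-- The transport of an endomorphism along an isomorphism. -/
def conjAlgHom {K : Type*} [Field K] (e : E ≃+* K) (τ : K →+* K)
    (h : ∀ c : F, τ (e (algebraMap F E c)) = e (algebraMap F E c)) : E →ₐ[F] E :=
  { e.symm.toRingHom.comp (τ.comp e.toRingHom) with
    commutes' := fun c => (congrArg e.symm (h c)).trans (e.symm_apply_apply _) }

theorem apply_conjAlgHom {K : Type*} [Field K] (e : E ≃+* K) (τ : K →+* K)
    (h : ∀ c : F, τ (e (algebraMap F E c)) = e (algebraMap F E c)) (x : E) :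
    e (conjAlgHom e τ h x) = τ (e x) :=
  e.apply_symm_apply _

theorem conjAlgHom_eq {K : Type*} [Field K] {e : E ≃+* K} {τ : K →+* K}
    {h : ∀ c : F, τ (e (algebraMap F E c)) = e (algebraMap F E c)} {x y : E} (hxy : τ (e x) = e y) :
    conjAlgHom e τ h x = y :=
  e.injective ((apply_conjAlgHom e τ h x).trans hxy)

theorem surjective_of_conjAlgHom_surjective {K : Type*} [Field K] (e : E ≃+* K) (τ : K →+* K)
    (h : ∀ c : F, τ (e (algebraMap F E c)) = e (algebraMap F E c))
    (hs : Function.Surjective (conjAlgHom e τ h)) : Function.Surjective τ := by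
  intro y
  obtain ⟨x, hx⟩ := hs (e.symm y)
  exact ⟨e x, by rw [← apply_conjAlgHom e τ h, hx, e.apply_symm_apply]⟩

/-- The infinite orbit of `x` leaves no constants beyond the image of `F`, so the field of constants
is a copy of `F`. -/
theorem isAlgClosed_constants [IsAlgClosed F] {K : Type*} [Field K] [PhiSigmaRing K] (e : E ≃+* K)
    (h : ∀ c : F, phi (e (algebraMap F E c)) = e (algebraMap F E c)) {x : E}
    (halg : ∀ y : E, IsAlgebraic (Algebra.adjoin F {x}) y)
    (hφ : Function.Injective fun k : ℕ => (conjAlgHom e phi h)^[k] x) :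
    IsAlgClosed (constants K) := by
  let f : F →+* constants K := (e.toRingHom.comp (algebraMap F E)).codRestrict (constants K) h
  refine isAlgClosed_of_ringEquiv (RingEquiv.ofBijective f ⟨RingHom.injective f, ?_⟩)
  rintro ⟨c, hc⟩
  have hc' : phi c = c := hc
  obtain ⟨a, ha⟩ := mem_range_algebraMap_of_map_eq halg (conjAlgHom e phi h) hφ
    (c := e.symm c) (conjAlgHom_eq (by rw [e.apply_symm_apply, hc']))
  exact ⟨a, Subtype.ext ((congrArg e ha).trans (e.apply_symm_apply c))⟩

end

theorem charZero_of_ringEquiv {E K : Type*} [Field E] [Algebra ℂ E] [Field K] (e : E ≃+* K) :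
    CharZero K :=
  charZero_of_injective_ringHom (e.toRingHom.comp (algebraMap ℂ E)).injective

section

variable {K : Type*} [Field K] [PhiSigmaRing K]

theorem IsCase2S.base (h : IsCase2S K) :
    CharZero K ∧ Function.Surjective (sigma : K →+* K) ∧ IsAlgClosed (constants K) := by
  obtain ⟨e, h₁, h₂, hind, hφC, hσC, hφX, hσX⟩ := h
  have hh : h₁ ≠ 0 := hind.ne_zero 0
  rw [← RatFunc.algebraMap_eq_C] at hφC hσC hφX hσX
  have htop : ∀ N : IntermediateField ℂ (RatFunc ℂ), RatFunc.X ∈ N → ∀ y, y ∈ N := by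
    intro N hN y
    have h1 : IntermediateField.adjoin ℂ {(RatFunc.X : RatFunc ℂ)} ≤ N :=
      IntermediateField.adjoin_le_iff.2 (Set.singleton_subset_iff.2 hN)
    rw [RatFunc.adjoin_X] at h1
    exact h1 IntermediateField.mem_top
  refine ⟨charZero_of_ringEquiv e, ?_, ?_⟩
  · refine surjective_of_conjAlgHom_surjective e _ hσC ?_
    refine htop (conjAlgHom e sigma hσC).fieldRange ⟨RatFunc.X - algebraMap ℂ _ h₂, ?_⟩
    change conjAlgHom e sigma hσC _ = _
    rw [map_sub, AlgHom.commutes, conjAlgHom_eq hσX, add_sub_cancel_right]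
  · refine isAlgClosed_constants e hφC (x := RatFunc.X)
      (htop (algebraicOverAdjoin ℂ RatFunc.X) (self_mem_algebraicOverAdjoin _)) ?_
    have hk : ∀ k : ℕ, (conjAlgHom e phi hφC)^[k] RatFunc.X =
        RatFunc.X + algebraMap ℂ _ (k * h₁) := by
      intro k
      induction k with
      | zero => simp
      | succ k ih =>
        rw [Function.iterate_succ_apply', ih, map_add, AlgHom.commutes, conjAlgHom_eq hφX,
          add_assoc, ← map_add]
        congr 2
        push_cast
        ring
    intro k l hkl
    simp only [hk] at hkl
    have := mul_right_cancel₀ hh ((algebraMap ℂ (RatFunc ℂ)).injective (add_left_cancel hkl))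
    exact_mod_cast this

end

/-! ### Ramified rational functions and their `ℂ`-endomorphisms -/

namespace RamifiedRatFunc

/-- The element `x^{1/j}`. -/
noncomputable def root (j : ℕ+) : RamifiedRatFunc :=
  ⟨HahnSeries.single (1 / (j : ℚ)) 1,
    (le_iSup (fun j : ℕ+ => IntermediateField.adjoin ℂ
      {HahnSeries.single (1 / (j : ℚ)) (1 : ℂ)}) j)
      (IntermediateField.mem_adjoin_simple_self ℂ _)⟩

theorem root_pow (j p : ℕ+) : root (j * p) ^ (p : ℕ) = root j := by
  refine Subtype.ext ?_
  change HahnSeries.single (1 / ((j * p : ℕ+) : ℚ)) (1 : ℂ) ^ (p : ℕ) = HahnSeries.single _ 1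
  rw [HahnSeries.single_pow, one_pow]
  congr 1
  have : (p : ℚ) ≠ 0 := by positivity
  simp only [nsmul_eq_mul, PNat.mul_coe]
  push_cast
  field_simp

theorem root_pow_self (j : ℕ+) : root j ^ (j : ℕ) = X := by
  have h := root_pow 1 j
  rw [one_mul] at h
  rw [h]
  refine Subtype.ext ?_
  change HahnSeries.single (1 / ((1 : ℕ+) : ℚ)) (1 : ℂ) = HahnSeries.single 1 1
  simp

theorem mem_of_root_mem {N : IntermediateField ℂ RamifiedRatFunc} (hN : ∀ j, root j ∈ N)
    (y : RamifiedRatFunc) : y ∈ N := by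
  have h : RamifiedRatFunc ≤ N.map RamifiedRatFunc.val :=
    iSup_le fun j => IntermediateField.adjoin_le_iff.2
      (Set.singleton_subset_iff.2 ⟨root j, hN j, rfl⟩)
  obtain ⟨z, hz, hzy⟩ := h y.2
  rwa [← Subtype.ext hzy]

theorem isAlgebraic (y : RamifiedRatFunc) : IsAlgebraic (Algebra.adjoin ℂ {X}) y :=
  mem_of_root_mem (N := algebraicOverAdjoin ℂ X) (fun j => mem_algebraicOverAdjoin.2 <|
    IsAlgebraic.of_pow j.pos (by
      rw [root_pow_self]
      exact self_mem_algebraicOverAdjoin _)) y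

theorem root_ne_zero (j : ℕ+) : root j ≠ 0 := fun h =>
  HahnSeries.single_ne_zero (a := 1 / (j : ℚ)) (one_ne_zero (α := ℂ)) (congrArg Subtype.val h)

theorem X_ne_zero : X ≠ 0 := by
  rw [← root_pow_self 1]
  exact pow_ne_zero _ (root_ne_zero 1)

theorem X_pow_injective : Function.Injective fun k : ℕ => X ^ k := by
  intro k l h
  have h1 : HahnSeries.single (1 : ℚ) (1 : ℂ) ^ k = HahnSeries.single (1 : ℚ) (1 : ℂ) ^ l :=
    congrArg Subtype.val h
  rw [HahnSeries.single_pow, HahnSeries.single_pow, one_pow, one_pow] at h1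
  have h2 := congrArg HahnSeries.order h1
  rw [HahnSeries.order_single one_ne_zero, HahnSeries.order_single one_ne_zero] at h2
  simpa using h2

theorem smul_eq (q : ℂ) (y : RamifiedRatFunc) : q • y = algebraMap ℂ RamifiedRatFunc q * y :=
  Subtype.ext (Algebra.smul_def q (y : HahnSeries ℚ ℂ))

/-- With `r` a `jp`-th root of `q`, the elements `τ(x^{1/(jp)})` and `r x^{1/j}` have the same
`jp`-th power. They differ by a root of unity, which lies in `ℂ`, so every `x^{1/j}` is in the range
whichever roots `τ` selects. -/
theorem surjective_of_apply_X (τ : RamifiedRatFunc →ₐ[ℂ] RamifiedRatFunc) {q : ℂ} (hq : q ≠ 0)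
    {p : ℕ} (hp : p ≠ 0) (hX : τ X = algebraMap ℂ _ q * X ^ p) : Function.Surjective τ := by
  refine mem_of_root_mem (N := τ.fieldRange) fun j => ?_
  lift p to ℕ+ using Nat.pos_of_ne_zero hp
  have hm : 0 < ((j * p : ℕ+) : ℕ) := (j * p).pos
  obtain ⟨r, hr⟩ := IsAlgClosed.exists_pow_nat_eq q hm
  have hr0 : r ≠ 0 := by
    rintro rfl
    exact hq (by rw [← hr, zero_pow hm.ne'])
  set z := algebraMap ℂ RamifiedRatFunc r * root j with hz
  have hz0 : z ≠ 0 := mul_ne_zero ((map_ne_zero _).2 hr0) (root_ne_zero j)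
  have h1 : τ (root (j * p)) ^ ((j * p : ℕ+) : ℕ) = z ^ ((j * p : ℕ+) : ℕ) := by
    rw [← map_pow, root_pow_self, hX, mul_pow, ← map_pow, hr, PNat.mul_coe, pow_mul, root_pow_self]
  have h2 : IsAlgebraic ℂ (τ (root (j * p)) / z) := by
    refine IsAlgebraic.of_pow hm ?_
    rw [div_pow, h1, div_self (pow_ne_zero _ hz0)]
    exact isAlgebraic_one
  obtain ⟨ζ, hζ⟩ := mem_range_algebraMap_of_isAlgebraic h2
  have hw : τ (root (j * p)) ≠ 0 := (map_ne_zero τ).2 (root_ne_zero _)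
  have h3 : root j = τ (root (j * p)) * (algebraMap ℂ RamifiedRatFunc (ζ * r))⁻¹ := by
    rw [map_mul, hζ]
    have hr' : algebraMap ℂ RamifiedRatFunc r ≠ 0 := (map_ne_zero _).2 hr0
    have hj := root_ne_zero j
    rw [hz]
    field_simp
  rw [h3]
  exact mul_mem ⟨_, rfl⟩ (inv_mem (algebraMap_mem _ _))

end RamifiedRatFunc

section

variable {K : Type*} [Field K] [PhiSigmaRing K]

theorem IsCase2Q.base (h : IsCase2Q K) :
    CharZero K ∧ Function.Surjective (sigma : K →+* K) ∧ IsAlgClosed (constants K) := by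
  obtain ⟨e, q₁, q₂, ⟨hq₁, hq₂, hind⟩, -, hφC, hσC, hφX, hσX⟩ := h
  refine ⟨charZero_of_ringEquiv e, surjective_of_conjAlgHom_surjective e _ hσC
    (RamifiedRatFunc.surjective_of_apply_X _ hq₂ one_ne_zero
      (by rw [conjAlgHom_eq hσX, pow_one, RamifiedRatFunc.smul_eq])),
    isAlgClosed_constants e hφC RamifiedRatFunc.isAlgebraic ?_⟩
  have hk : ∀ k : ℕ, (conjAlgHom e phi hφC)^[k] RamifiedRatFunc.X =
      algebraMap ℂ _ (q₁ ^ k) * RamifiedRatFunc.X := by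
    intro k
    induction k with
    | zero => simp
    | succ k ih => rw [Function.iterate_succ_apply', ih, map_mul, AlgHom.commutes,
        conjAlgHom_eq hφX, RamifiedRatFunc.smul_eq, ← mul_assoc, ← map_mul, ← pow_succ]
  intro k l hkl
  simp only [hk] at hkl
  have h1 : q₁ ^ k = q₁ ^ l := (algebraMap ℂ RamifiedRatFunc).injective
    (mul_right_cancel₀ RamifiedRatFunc.X_ne_zero hkl)
  have h2 := (hind (k - l) 0 (by
    rw [zpow_zero, mul_one, zpow_sub₀ hq₁, zpow_natCast, zpow_natCast, h1,
      div_self (pow_ne_zero _ hq₁)])).1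
  omega

theorem IsCase2M.base (h : IsCase2M K) :
    CharZero K ∧ Function.Surjective (sigma : K →+* K) ∧ IsAlgClosed (constants K) := by
  obtain ⟨e, p₁, p₂, ⟨hp₁, hp₂, hind⟩, hφC, hσC, hφX, hσX⟩ := h
  -- Multiplicative independence excludes `p₁ = 1`, since `1¹ · p₂⁰ = 1`; hence the exponents `p₁ᵏ`
  -- are distinct.
  have hp₁' : 2 ≤ p₁ := by
    rcases p₁ with _ | _ | p
    · simp at hp₁
    · simpa using hind 1 0
    · omega
  refine ⟨charZero_of_ringEquiv e, surjective_of_conjAlgHom_surjective e _ hσC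
    (RamifiedRatFunc.surjective_of_apply_X _ one_ne_zero (Nat.cast_ne_zero.1 hp₂)
      (by rw [conjAlgHom_eq hσX, map_one, one_mul])),
    isAlgClosed_constants e hφC RamifiedRatFunc.isAlgebraic ?_⟩
  have hk : ∀ k : ℕ, (conjAlgHom e phi hφC)^[k] RamifiedRatFunc.X =
      RamifiedRatFunc.X ^ p₁ ^ k := by
    intro k
    induction k with
    | zero => simp
    | succ k ih => rw [Function.iterate_succ_apply', ih, map_pow, conjAlgHom_eq hφX, ← pow_mul,
        pow_succ']
  intro k l hkl
  simp only [hk] at hkl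
  exact Nat.pow_right_injective hp₁' (RamifiedRatFunc.X_pow_injective hkl)

end

/-! ### The two parts of the theorem -/

theorem mainTheorem9 {K : Type u} [Field K] [PhiSigmaRing K] {n : ℕ} (A : GL (Fin n) K)
    {L : Type v} [CommRing L] [PhiSigmaRing L] [Algebra K L] [PhiSigmaAlgebra K L]
    (P : SigmaPVExtension A L) :
    (CharZero K → Function.Surjective (SigmaRing.sigma : K →+* K) → IsAlgClosed (constants K) →
      GaloisGroupIsSigmaIntegral K P.ring →
      ∃ M : Subalgebra K P.ring, (M : Set P.ring) = sigmaBoundedElements K P.ring ∧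
        (∀ x ∈ M, SigmaRing.sigma x ∈ M) ∧ IsGaloisStable.{u, v, w} K M) ∧
    (IsCase2S K ∨ IsCase2Q K ∨ IsCase2M K → IsField L →
      ∃ M : Subalgebra K P.ring, (M : Set P.ring) = sigmaAlgebraicElements K P.ring ∧
        (∀ x ∈ M, PhiSigmaRing.phi x ∈ M) ∧ (∀ x ∈ M, SigmaRing.sigma x ∈ M) ∧
        IsGaloisStable.{u, v, w} K M) := by
  constructor
  · intro _ hσ _ hG
    have := P.ring_nontrivial
    have : IsDomain P.ring :=
      isDomain_of_torsorMap_bijective P.torsorMap_ring_bijective hG.1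
    refine ⟨sigmaAlgebraicSubalgebra K P.ring P.sigma_ring_injective, ?_,
      fun x hx => sigma_mem_sigmaAlgebraicElements P.sigma_ring_injective hx,
      P.isGaloisStable hσ⟩
    -- Once `S` is a domain with injective `σ`, both conditions say that the orbit of `b` has finite
    -- rank, so `μ(S|K) = π(S|K)`.
    ext b
    exact (mem_sigmaAlgebraicElements_iff P.sigma_ring_injective).trans
      mem_sigmaBoundedElements_iff.symm
  · intro hK hL
    obtain ⟨_, hσ, _⟩ : CharZero K ∧ Function.Surjective (sigma : K →+* K) ∧
        IsAlgClosed (constants K) := by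
      rcases hK with h | h | h
      exacts [h.base, h.base, h.base]
    have : IsDomain L := hL.isDomain
    exact ⟨sigmaAlgebraicSubalgebra K P.ring P.sigma_ring_injective, rfl,
      fun x hx => phi_mem_sigmaAlgebraicElements hx,
      fun x hx => sigma_mem_sigmaAlgebraicElements P.sigma_ring_injective hx,
      P.isGaloisStable hσ⟩
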